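/- Let $n\in\mathbb{N}$, let $\lambda_0\in L^\infty(0,1;\mathbb{R})$ satisfy $\lambda_0(\zeta)\ge\epsilon$ for a.e. $\zeta\in(0,1)$ and some $\epsilon>0$, let $M\in L^\infty(0,1;\mathbb{C}^{n\times n})$ and $K,L\in\mathbb{C}^{n\times n}$. Let $P:[0,1]\to\mathbb{C}^{n\times n}$ be the unique (absolutely continuous, Carathéodory) solution of $P'(\zeta)=\lambda_0(\zeta)^{-1}M(\zeta)P(\zeta)$, $P(0)=I$. Let $X=L^2(0,1;\mathbb{C}^n)$, equipped with the inner product $\langle f,g\rangle_X=\int_0^1\lambda_0(\zeta)g(\zeta)^*f(\zeta)\,\mathrm{d}\zeta$, and define the unbounded operator $\mathfrak{A}$ on $X$ by $$\mathfrak{A}g=-\frac{\mathrm{d}}{\mathrm{d}\zeta}(\lambda_0 g),\qquad D(\mathfrak{A})=\{g\in X\mid \lambda_0 g\in H^1(0,1;\mathbb{C}^n),\ \lambda_0(0)Kg(0)+\lambda_0(1)LP(1)g(1)=0\},$$ where $\lambda_0(0)g(0)$ and $\lambda_0(1)g(1)$ denote the values at $0$ and $1$ of the absolutely continuous representative of $\lambda_0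 g$. Then $\mathfrak{A}$ is the infinitesimal generator of a $C_0$-semigroup of bounded linear operators on $X$ if and only if the matrix $K$ is invertible. -/

import Mathlib

open MeasureTheory Set Filter Topology
open scoped NNReal ENNReal Matrix

/-! ### Strongly continuous semigroups and their generators -/

/-- A `C₀`-semigroup of bounded linear operators on a complex normed space `X`. -/
structure C0Semigroup (X : Type*) [NormedAddCommGroup X] [NormedSpace ℂ X] where
  /-- the operator at time `t ≥ 0` -/
  op : ℝ≥0 → X →L[ℂ] X
  op_zero : op 0 = ContinuousLinearMap.id ℂ X
  op_add : ∀ s t : ℝ≥0, op (s + t) = (op s).comp (op t)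
  strongly_continuous : ∀ x : X, Tendsto (fun t : ℝ≥0 => op t x) (𝓝[>] 0) (𝓝 x)

/-- The unbounded operator `A` is the infinitesimal generator of the semigroup `T`: a vector `x`
lies in `D(A)` with `A x = y` exactly when `(T(t) x - x) / t → y` as `t ↓ 0`. -/
def IsGeneratorOf {X : Type*} [NormedAddCommGroup X] [NormedSpace ℂ X]
    (A : X →ₗ.[ℂ] X) (T : C0Semigroup X) : Prop :=
  ∀ x y : X, (x, y) ∈ A.graph ↔
    Tendsto (fun t : ℝ≥0 => (((t : ℝ) : ℂ)⁻¹) • (T.op t x - x)) (𝓝[>] 0) (𝓝 y)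

/-- `A` is the infinitesimal generator of some `C₀`-semigroup. -/
def GeneratesC0Semigroup {X : Type*} [NormedAddCommGroup X] [NormedSpace ℂ X]
    (A : X →ₗ.[ℂ] X) : Prop :=
  ∃ T : C0Semigroup X, IsGeneratorOf A T

/-! ### The coefficients and the state space -/

/-- Lebesgue measure on the unit interval `(0, 1)`. -/
noncomputable def unitMeasure : Measure ℝ := volume.restrict (Ioo 0 1)

/-- `lam ∈ L^∞(0,1;ℝ)` and `lam ≥ ε > 0` almost everywhere. -/
structure IsSpeed (lam : ℝ → ℝ) : Prop where
  memLp : MemLp lam ∞ unitMeasure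
  bounded_below : ∃ ε : ℝ, 0 < ε ∧ ∀ᵐ ζ ∂unitMeasure, ε ≤ lam ζ

/-- `M ∈ L^∞(0,1;ℂ^{n×n})`. -/
def IsBoundedMatrixFunction {n : ℕ} (M : ℝ → Matrix (Fin n) (Fin n) ℂ) : Prop :=
  ∀ i j, MemLp (fun ζ => M ζ i j) ∞ unitMeasure

/-- The measure `lam(ζ) dζ` on `(0, 1)`. -/
noncomputable def weightedMeasure (lam : ℝ → ℝ) : Measure ℝ :=
  unitMeasure.withDensity fun ζ => ENNReal.ofReal (lam ζ)

/-- The state space `L²(0,1;ℂⁿ)` with the inner product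
`⟨f, g⟩ = ∫₀¹ lam(ζ) g(ζ)^* f(ζ) dζ`. For `lam` bounded and bounded away from zero this is the
usual `L²(0,1;ℂⁿ)` with an equivalent norm. -/
abbrev StateSpace (n : ℕ) (lam : ℝ → ℝ) : Type :=
  Lp (EuclideanSpace ℂ (Fin n)) 2 (weightedMeasure lam)

/-! ### The matrix differential equation -/

/-- `P` is a (Carathéodory) solution on `[0,1]` of
`P'(ζ) = lam(ζ)⁻¹ M(ζ) P(ζ)`, `P(0) = I`. -/
structure IsFundamentalMatrix {n : ℕ} (lam : ℝ → ℝ) (M : ℝ → Matrix (Fin n) (Fin n) ℂ)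
    (P : ℝ → Matrix (Fin n) (Fin n) ℂ) : Prop where
  continuousOn : ContinuousOn P (Icc 0 1)
  integral_eq : ∀ ζ ∈ Icc (0 : ℝ) 1, ∀ i j,
    P ζ i j = (1 : Matrix (Fin n) (Fin n) ℂ) i j
      + ∫ s in (0 : ℝ)..ζ, ((lam s : ℝ) : ℂ)⁻¹ * (M s * P s) i j

/-- The solution `P` of `P' = lam⁻¹ M P`, `P(0) = I` (it exists and is unique on `[0,1]`, see
`isFundamentalMatrix_fundamentalMatrix` and `IsFundamentalMatrix.eqOn` below). -/
noncomputable def fundamentalMatrix {n : ℕ} (lam : ℝ → ℝ) (M : ℝ → Matrix (Fin n) (Fin n) ℂ) :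
    ℝ → Matrix (Fin n) (Fin n) ℂ :=
  Classical.epsilon (IsFundamentalMatrix lam M)

/-- Picard's theorem on `[0,1]` for a Carathéodory right-hand side with a Lipschitz bound. -/
theorem caratheodory_picard {E : Type*} [NormedAddCommGroup E] [NormedSpace ℝ E] [CompleteSpace E]
    (F : ℝ → E → E) (C : ℝ) (hC : 0 ≤ C)
    (hmeas : ∀ y : ℝ → E, Continuous y →
      AEStronglyMeasurable (fun s => F s (y s)) (volume.restrict (Ioc 0 1)))
    (hzero : ∀ s, F s 0 = 0)
    (hlip : ∀ᵐ s ∂(volume.restrict (Ioc (0 : ℝ) 1)), ∀ u v, ‖F s u - F s v‖ ≤ C * ‖u - v‖)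
    (y₀ : E) :
    (∀ Y : ℝ → E, ContinuousOn Y (Icc 0 1) → ∀ ζ ∈ Icc (0 : ℝ) 1,
      IntervalIntegrable (fun s => F s (Y s)) volume 0 ζ) ∧
    (∃ Y : ℝ → E, ContinuousOn Y (Icc 0 1) ∧
      ∀ ζ ∈ Icc (0 : ℝ) 1, Y ζ = y₀ + ∫ s in (0 : ℝ)..ζ, F s (Y s)) ∧
    ∀ Y Z : ℝ → E, ContinuousOn Y (Icc 0 1) → ContinuousOn Z (Icc 0 1) →
      (∀ ζ ∈ Icc (0 : ℝ) 1, Y ζ = y₀ + ∫ s in (0 : ℝ)..ζ, F s (Y s)) →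
      (∀ ζ ∈ Icc (0 : ℝ) 1, Z ζ = y₀ + ∫ s in (0 : ℝ)..ζ, F s (Z s)) →
      EqOn Y Z (Icc 0 1) := by
  have h01 : (0 : ℝ) ≤ 1 := zero_le_one
  let ext : C(Icc (0 : ℝ) 1, E) → ℝ → E := fun y s => y (projIcc 0 1 h01 s)
  have hext : ∀ y, Continuous (ext y) := fun y => y.continuous.comp continuous_projIcc
  have hint : ∀ y, IntervalIntegrable (fun s => F s (ext y s)) volume 0 1 := by
    intro y
    rw [intervalIntegrable_iff_integrableOn_Ioc_of_le h01]
    refine Integrable.of_bound (hmeas _ (hext y)) (C * ‖y‖) ?_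
    filter_upwards [hlip] with s hs
    have := hs (ext y s) 0
    rw [hzero, sub_zero, sub_zero] at this
    exact this.trans (mul_le_mul_of_nonneg_left (y.norm_coe_le_norm _) hC)
  have hint' : ∀ y, ∀ ζ ∈ Icc (0 : ℝ) 1,
      IntervalIntegrable (fun s => F s (ext y s)) volume 0 ζ := fun y ζ hζ =>
    (hint y).mono_set (by
      rw [uIcc_of_le hζ.1, uIcc_of_le h01]
      exact Icc_subset_Icc_right hζ.2)
  let T : C(Icc (0 : ℝ) 1, E) → C(Icc (0 : ℝ) 1, E) := fun y =>
    { toFun := fun ζ => y₀ + ∫ s in (0 : ℝ)..ζ, F s (ext y s)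
      continuous_toFun := by
        refine continuous_const.add ?_
        have := intervalIntegral.continuousOn_primitive_interval (a := (0 : ℝ)) (b := 1)
          (f := fun s => F s (ext y s)) (μ := volume) (by
            rw [uIcc_of_le h01, integrableOn_Icc_iff_integrableOn_Ioc]
            exact (intervalIntegrable_iff_integrableOn_Ioc_of_le h01).1 (hint y))
        rw [uIcc_of_le h01] at this
        exact continuousOn_iff_continuous_domRestrict.1 this }
  have hiter : ∀ k y z, ∀ ζ : Icc (0 : ℝ) 1,
      ‖(T^[k] y) ζ - (T^[k] z) ζ‖ ≤ C ^ k * (ζ : ℝ) ^ k / (k.factorial : ℝ) * ‖y - z‖ := by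
    intro k y z
    induction k with
    | zero =>
      intro ζ
      simpa using (y - z).norm_coe_le_norm ζ
    | succ k ih =>
      intro ζ
      rw [Function.iterate_succ_apply', Function.iterate_succ_apply']
      set u := T^[k] y
      set v := T^[k] z
      have h1 : (T u) ζ - (T v) ζ = ∫ s in (0 : ℝ)..ζ, (F s (ext u s) - F s (ext v s)) := by
        rw [intervalIntegral.integral_sub (hint' u ζ ζ.2) (hint' v ζ ζ.2)]
        change (y₀ + _) - (y₀ + _) = _
        abel
      have h2 : ∀ᵐ s ∂volume, s ∈ Ioc (0 : ℝ) ζ → ‖F s (ext u s) - F s (ext v s)‖ ≤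
          C * (C ^ k * s ^ k / (k.factorial : ℝ) * ‖y - z‖) := by
        rw [ae_restrict_iff' measurableSet_Ioc] at hlip
        filter_upwards [hlip] with s hs hsm
        have hs1 : s ∈ Icc (0 : ℝ) 1 := ⟨hsm.1.le, hsm.2.trans ζ.2.2⟩
        refine (hs ⟨hsm.1, hs1.2⟩ _ _).trans (mul_le_mul_of_nonneg_left ?_ hC)
        have := ih ⟨s, hs1⟩
        simpa only [ext, projIcc_of_mem h01 hs1] using this
      rw [h1]
      refine (intervalIntegral.norm_integral_le_of_norm_le ζ.2.1 h2
        (Continuous.intervalIntegrable (by fun_prop) _ _)).trans (le_of_eq ?_)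
      have h3 : ∀ s : ℝ, C * (C ^ k * s ^ k / (k.factorial : ℝ) * ‖y - z‖) =
          (C ^ (k + 1) / (k.factorial : ℝ) * ‖y - z‖) * s ^ k := fun s => by ring
      simp_rw [h3]
      rw [intervalIntegral.integral_const_mul, integral_pow, Nat.factorial_succ]
      push_cast
      have : (k.factorial : ℝ) ≠ 0 := by positivity
      have : (k : ℝ) + 1 ≠ 0 := by positivity
      field_simp
      simp
  obtain ⟨k, hk⟩ : ∃ k : ℕ, C ^ k / (k.factorial : ℝ) < 1 :=
    ((FloorSemiring.tendsto_pow_div_factorial_atTop C).eventually (gt_mem_nhds one_pos)).exists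
  have hcon : ContractingWith (Real.toNNReal (C ^ k / (k.factorial : ℝ))) (T^[k]) := by
    refine ⟨Real.toNNReal_lt_one.2 hk, LipschitzWith.of_dist_le_mul fun y z => ?_⟩
    rw [Real.coe_toNNReal _ (by positivity)]
    rw [ContinuousMap.dist_le (mul_nonneg (by positivity) dist_nonneg)]
    intro ζ
    rw [dist_eq_norm, dist_eq_norm]
    refine (hiter k y z ζ).trans (mul_le_mul_of_nonneg_right ?_ (norm_nonneg _))
    have : (ζ : ℝ) ^ k ≤ 1 := pow_le_one₀ ζ.2.1 ζ.2.2
    gcongr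
    exact mul_le_of_le_one_right (by positivity) this
  refine ⟨?_, ?_, ?_⟩
  · intro Y hY ζ hζ
    let y : C(Icc (0 : ℝ) 1, E) :=
      ⟨(Icc (0 : ℝ) 1).domRestrict Y, continuousOn_iff_continuous_domRestrict.1 hY⟩
    refine (hint' y ζ hζ).congr fun s hs => ?_
    rw [uIoc_of_le hζ.1] at hs
    have hs1 : s ∈ Icc (0 : ℝ) 1 := ⟨hs.1.le, hs.2.trans hζ.2⟩
    simp only [ext, projIcc_of_mem h01 hs1]
    rfl
  · have hfix := hcon.isFixedPt_fixedPoint_iterate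
    set y := ContractingWith.fixedPoint (T^[k]) hcon
    refine ⟨ext y, (hext y).continuousOn, fun ζ hζ => ?_⟩
    have : (T y) ⟨ζ, hζ⟩ = y ⟨ζ, hζ⟩ := by rw [hfix.eq]
    simp only [ext, projIcc_of_mem h01 hζ]
    exact this.symm
  · intro Y Z hY hZ hY' hZ'
    have key : ∀ W : ℝ → E, (hW : ContinuousOn W (Icc 0 1)) →
        (∀ ζ ∈ Icc (0 : ℝ) 1, W ζ = y₀ + ∫ s in (0 : ℝ)..ζ, F s (W s)) →
        Function.IsFixedPt (T^[k])
          ⟨(Icc (0 : ℝ) 1).domRestrict W, continuousOn_iff_continuous_domRestrict.1 hW⟩ := by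
      intro W hW hW'
      refine Function.IsFixedPt.iterate ?_ k
      ext ζ
      change y₀ + _ = W ζ
      rw [hW' ζ ζ.2]
      congr 1
      refine intervalIntegral.integral_congr fun s hs => ?_
      rw [uIcc_of_le ζ.2.1] at hs
      have hs1 : s ∈ Icc (0 : ℝ) 1 := ⟨hs.1, hs.2.trans ζ.2.2⟩
      simp only [ext, projIcc_of_mem h01 hs1]
      rfl
    have := hcon.fixedPoint_unique' (key Y hY hY') (key Z hZ hZ')
    intro ζ hζ
    exact congrArg (fun f : C(Icc (0 : ℝ) 1, E) => f ⟨ζ, hζ⟩) this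

theorem isFundamentalMatrix_exists_unique {n : ℕ} {lam : ℝ → ℝ}
    {M : ℝ → Matrix (Fin n) (Fin n) ℂ} (hlam : IsSpeed lam) (hM : IsBoundedMatrixFunction M) :
    (∃ P, IsFundamentalMatrix lam M P) ∧
      ∀ P Q, IsFundamentalMatrix lam M P → IsFundamentalMatrix lam M Q → EqOn P Q (Icc 0 1) := by
  classical
  obtain ⟨ε, hε, hlow⟩ := hlam.bounded_below
  let F : ℝ → (Fin n → Fin n → ℂ) → Fin n → Fin n → ℂ := fun s u i j =>
    ((lam s : ℝ) : ℂ)⁻¹ * ∑ k, M s i k * u k j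
  have hμ : unitMeasure = volume.restrict (Ioc (0 : ℝ) 1) := restrict_Ioo_eq_restrict_Ioc
  let e : Fin n → Fin n → ℂ := (1 : Matrix (Fin n) (Fin n) ℂ)
  let C : ℝ := ε⁻¹ * ∑ i, ∑ k, (eLpNorm (fun ζ => M ζ i k) ∞ unitMeasure).toReal
  have hC : 0 ≤ C := by positivity
  have hMb : ∀ᵐ s ∂unitMeasure, ∀ i k,
      ‖M s i k‖ ≤ (eLpNorm (fun ζ => M ζ i k) ∞ unitMeasure).toReal := by
    rw [ae_all_iff]; intro i
    rw [ae_all_iff]; intro k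
    filter_upwards [ae_le_eLpNormEssSup (f := fun ζ => M ζ i k) (μ := unitMeasure)] with s hs
    rw [← eLpNorm_exponent_top] at hs
    simpa using ENNReal.toReal_mono (hM i k).2.ne hs
  obtain ⟨hI, ⟨Y, hYc, hY⟩, huniq⟩ := caratheodory_picard F C hC
    (by
      intro y hy
      rw [← hμ]
      refine AEMeasurable.aestronglyMeasurable (aemeasurable_pi_iff.2 fun i =>
        aemeasurable_pi_iff.2 fun j => AEStronglyMeasurable.aemeasurable ?_)
      refine AEStronglyMeasurable.mul ?_ ?_
      · have h1 : AEMeasurable lam unitMeasure := hlam.memLp.1.aemeasurable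
        exact (Complex.measurable_ofReal.comp_aemeasurable h1).inv.aestronglyMeasurable
      · refine Finset.aestronglyMeasurable_fun_sum _ fun k _ => ?_
        refine (hM i k).1.mul (Continuous.aestronglyMeasurable ?_)
        fun_prop)
    (by intro s; ext i j; simp [F])
    (by
      rw [← hμ]
      filter_upwards [hMb, hlow] with s hs hl u v
      refine (pi_norm_le_iff_of_nonneg (by positivity)).2 fun i =>
        (pi_norm_le_iff_of_nonneg (by positivity)).2 fun j => ?_
      have h1 : (F s u - F s v) i j =
          ((lam s : ℝ) : ℂ)⁻¹ * ∑ k, M s i k * (u - v) k j := by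
        simp only [F, Pi.sub_apply, mul_sub, Finset.sum_sub_distrib]
      rw [h1, norm_mul, norm_inv, Complex.norm_real, Real.norm_of_nonneg (hε.le.trans hl)]
      have h2 : ‖∑ k, M s i k * (u - v) k j‖ ≤
          (∑ i, ∑ k, (eLpNorm (fun ζ => M ζ i k) ∞ unitMeasure).toReal) * ‖u - v‖ := by
        refine (norm_sum_le _ _).trans ?_
        have h3 : ∑ k, (eLpNorm (fun ζ => M ζ i k) ∞ unitMeasure).toReal ≤
            ∑ i, ∑ k, (eLpNorm (fun ζ => M ζ i k) ∞ unitMeasure).toReal :=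
          Finset.single_le_sum
            (f := fun i => ∑ k, (eLpNorm (fun ζ => M ζ i k) ∞ unitMeasure).toReal)
            (fun i _ => by positivity) (Finset.mem_univ i)
        refine le_trans ?_ (mul_le_mul_of_nonneg_right h3 (norm_nonneg _))
        rw [Finset.sum_mul]
        refine Finset.sum_le_sum fun k _ => ?_
        rw [norm_mul]
        exact mul_le_mul (hs i k) ((norm_le_pi_norm _ j).trans (norm_le_pi_norm (u - v) k))
          (norm_nonneg _) (by positivity)
      change _ ≤ ε⁻¹ * _ * _
      rw [mul_assoc]
      exact mul_le_mul (inv_anti₀ hε hl) h2 (norm_nonneg _) (by positivity))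
    e
  have hentry : ∀ Z : ℝ → Fin n → Fin n → ℂ, ContinuousOn Z (Icc 0 1) → ∀ ζ ∈ Icc (0 : ℝ) 1,
      ∀ i j, (∫ s in (0 : ℝ)..ζ, F s (Z s)) i j = ∫ s in (0 : ℝ)..ζ, F s (Z s) i j := by
    intro Z hZ ζ hζ i j
    let p : (Fin n → Fin n → ℂ) →L[ℝ] ℂ :=
      (ContinuousLinearMap.proj (R := ℝ) (φ := fun _ : Fin n => ℂ) j).comp
        (ContinuousLinearMap.proj (R := ℝ) (φ := fun _ : Fin n => (Fin n → ℂ)) i)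
    exact (p.intervalIntegral_comp_comm (hI Z hZ ζ hζ)).symm
  refine ⟨⟨Y, hYc, fun ζ hζ i j => ?_⟩, fun P Q hP hQ => ?_⟩
  · have h1 : Y ζ i j = (1 : Matrix (Fin n) (Fin n) ℂ) i j
        + (∫ s in (0 : ℝ)..ζ, F s (Y s)) i j := congrFun (congrFun (hY ζ hζ) i) j
    rw [h1, hentry Y hYc ζ hζ i j]
    rfl
  · have conv : ∀ P, IsFundamentalMatrix lam M P → ∀ ζ ∈ Icc (0 : ℝ) 1,
        (P ζ : Fin n → Fin n → ℂ) = e + ∫ s in (0 : ℝ)..ζ, F s (P s) := by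
      intro P hP ζ hζ
      funext i j
      refine (hP.integral_eq ζ hζ i j).trans ?_
      refine Eq.trans ?_ (congrArg (e i j + ·)
        (hentry P hP.continuousOn ζ hζ i j).symm)
      rfl
    exact huniq P Q hP.continuousOn hQ.continuousOn (conv P hP) (conv Q hQ)

theorem isFundamentalMatrix_fundamentalMatrix {n : ℕ} {lam : ℝ → ℝ}
    {M : ℝ → Matrix (Fin n) (Fin n) ℂ} (hlam : IsSpeed lam) (hM : IsBoundedMatrixFunction M) :
    IsFundamentalMatrix lam M (fundamentalMatrix lam M) :=
  Classical.epsilon_spec (isFundamentalMatrix_exists_unique hlam hM).1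

theorem IsFundamentalMatrix.eqOn {n : ℕ} {lam : ℝ → ℝ} {M P : ℝ → Matrix (Fin n) (Fin n) ℂ}
    (hlam : IsSpeed lam) (hM : IsBoundedMatrixFunction M) (hP : IsFundamentalMatrix lam M P) :
    EqOn P (fundamentalMatrix lam M) (Icc 0 1) :=
  (isFundamentalMatrix_exists_unique hlam hM).2 _ _ hP
    (isFundamentalMatrix_fundamentalMatrix hlam hM)

/-! ### The transport operator -/

/-- `f ∈ H¹(0,1;ℂⁿ)`, with absolutely continuous representative `h` on `[0,1]` and weak derivative
`h' ∈ L²(0,1;ℂⁿ)`. The boundary values of `f` are `h 0` and `h 1`. -/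
structure IsH1With {n : ℕ} (f h h' : ℝ → EuclideanSpace ℂ (Fin n)) : Prop where
  ae_eq : f =ᵐ[unitMeasure] h
  memLp : MemLp h' 2 unitMeasure
  integral_eq : ∀ ζ ∈ Icc (0 : ℝ) 1, h ζ = h 0 + ∫ s in (0 : ℝ)..ζ, h' s

theorem unitMeasure_absolutelyContinuous {lam : ℝ → ℝ} (hlam : IsSpeed lam) :
    unitMeasure ≪ weightedMeasure lam := by
  obtain ⟨ε, hε, hlow⟩ := hlam.bounded_below
  refine withDensity_absolutelyContinuous' hlam.memLp.1.aemeasurable.ennreal_ofReal ?_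
  filter_upwards [hlow] with s hs
  simpa using hε.trans_le hs

theorem MeasureTheory.MemLp.intervalIntegrable_unit {n : ℕ}
    {h' : ℝ → EuclideanSpace ℂ (Fin n)} (hh : MemLp h' 2 unitMeasure) :
    IntervalIntegrable h' volume 0 1 := by
  have : IsFiniteMeasure unitMeasure := by unfold unitMeasure; infer_instance
  rw [intervalIntegrable_iff_integrableOn_Ioo_of_le zero_le_one]
  exact hh.integrable (by norm_num)

theorem IsH1With.add {n : ℕ} {f₁ f₂ h₁ h₂ k₁ k₂ : ℝ → EuclideanSpace ℂ (Fin n)}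
    (H₁ : IsH1With f₁ h₁ k₁) (H₂ : IsH1With f₂ h₂ k₂) :
    IsH1With (f₁ + f₂) (h₁ + h₂) (k₁ + k₂) := by
  refine ⟨H₁.ae_eq.add H₂.ae_eq, H₁.memLp.add H₂.memLp, fun ζ hζ => ?_⟩
  have hsub : uIcc 0 ζ ⊆ uIcc (0 : ℝ) 1 := by
    rw [uIcc_of_le hζ.1, uIcc_of_le zero_le_one]
    exact Icc_subset_Icc_right hζ.2
  simp only [Pi.add_apply]
  rw [intervalIntegral.integral_add (H₁.memLp.intervalIntegrable_unit.mono_set hsub)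
    (H₂.memLp.intervalIntegrable_unit.mono_set hsub), H₁.integral_eq ζ hζ, H₂.integral_eq ζ hζ]
  abel

theorem IsH1With.const_smul {n : ℕ} {f h k : ℝ → EuclideanSpace ℂ (Fin n)} (c : ℂ)
    (H : IsH1With f h k) : IsH1With (c • f) (c • h) (c • k) := by
  refine ⟨H.ae_eq.const_smul c, H.memLp.const_smul c, fun ζ hζ => ?_⟩
  simp only [Pi.smul_apply]
  rw [intervalIntegral.integral_smul, H.integral_eq ζ hζ, smul_add]

theorem IsH1With.congr {n : ℕ} {f g h k : ℝ → EuclideanSpace ℂ (Fin n)}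
    (H : IsH1With f h k) (hfg : g =ᵐ[unitMeasure] f) : IsH1With g h k :=
  ⟨hfg.trans H.ae_eq, H.memLp, H.integral_eq⟩

/-- The weak derivative of (a function almost everywhere equal to) zero vanishes. -/
theorem IsH1With.deriv_ae_eq_zero {n : ℕ} {f h k : ℝ → EuclideanSpace ℂ (Fin n)}
    (H : IsH1With f h k) (hf : f =ᵐ[unitMeasure] 0) : k =ᵐ[unitMeasure] 0 := by
  have hk := H.memLp.intervalIntegrable_unit
  have hcont : ContinuousOn h (Ioo 0 1) := by
    have h1 := intervalIntegral.continuousOn_primitive_interval (a := (0 : ℝ)) (b := 1)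
      (f := k) (μ := volume) (by
        rw [uIcc_of_le zero_le_one, integrableOn_Icc_iff_integrableOn_Ioc]
        exact (intervalIntegrable_iff_integrableOn_Ioc_of_le zero_le_one).1 hk)
    rw [uIcc_of_le zero_le_one] at h1
    exact ((continuousOn_const.add h1).congr H.integral_eq).mono Ioo_subset_Icc_self
  have hzero : EqOn h 0 (Ioo 0 1) :=
    Measure.eqOn_open_of_ae_eq (H.ae_eq.symm.trans hf) isOpen_Ioo hcont continuousOn_const
  have hder := hk.ae_hasDerivAt_integral
  unfold unitMeasure
  filter_upwards [ae_restrict_of_ae hder, ae_restrict_mem measurableSet_Ioo] with x hx hxm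
  have hx' := hx (by rw [uIcc_of_le zero_le_one]; exact Ioo_subset_Icc_self hxm) 0
    (by rw [uIcc_of_le zero_le_one]; exact left_mem_Icc.2 zero_le_one)
  have hconst : (fun y => ∫ s in (0 : ℝ)..y, k s) =ᶠ[𝓝 x] fun _ => -h 0 := by
    filter_upwards [isOpen_Ioo.mem_nhds hxm] with y hy
    have h1 := H.integral_eq y (Ioo_subset_Icc_self hy)
    rw [hzero hy] at h1
    exact (neg_eq_of_add_eq_zero_right h1.symm).symm
  exact hx'.unique ((hasDerivAt_const x (-h 0)).congr_of_eventuallyEq hconst)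

/-- The graph of the transport operator: the pairs `(g, f)` in `X × X` such that
`lam g ∈ H¹(0,1;ℂⁿ)`, `K (lam g)(0) + L P(1) (lam g)(1) = 0` and `f = -(lam g)'`. -/
noncomputable def transportGraph {n : ℕ} {lam : ℝ → ℝ} (hlam : IsSpeed lam)
    (M : ℝ → Matrix (Fin n) (Fin n) ℂ) (K L : Matrix (Fin n) (Fin n) ℂ) :
    Submodule ℂ (StateSpace n lam × StateSpace n lam) where
  carrier := {p | ∃ h h' : ℝ → EuclideanSpace ℂ (Fin n),
    IsH1With (fun ζ => ((lam ζ : ℝ) : ℂ) • p.1 ζ) h h' ∧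
    K *ᵥ (h 0).ofLp + (L * fundamentalMatrix lam M 1) *ᵥ (h 1).ofLp = 0 ∧
    p.2 =ᵐ[unitMeasure] -h'}
  zero_mem' := by
    have hz := (unitMeasure_absolutelyContinuous hlam).ae_le
      (Lp.coeFn_zero (EuclideanSpace ℂ (Fin n)) 2 (weightedMeasure lam))
    refine ⟨0, 0, ⟨?_, MemLp.zero, by simp⟩, by simp, ?_⟩
    · filter_upwards [hz] with ζ h
      simp only [Prod.fst_zero]
      rw [h]
      simp
    · filter_upwards [hz] with ζ h
      simp only [Prod.snd_zero]
      rw [h]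
      simp
  add_mem' := by
    rintro p q ⟨h₁, k₁, H₁, B₁, E₁⟩ ⟨h₂, k₂, H₂, B₂, E₂⟩
    have ha₁ := (unitMeasure_absolutelyContinuous hlam).ae_le (Lp.coeFn_add p.1 q.1)
    have ha₂ := (unitMeasure_absolutelyContinuous hlam).ae_le (Lp.coeFn_add p.2 q.2)
    refine ⟨h₁ + h₂, k₁ + k₂, (H₁.add H₂).congr ?_, ?_, ?_⟩
    · filter_upwards [ha₁] with ζ h
      simp only [Prod.fst_add, Pi.add_apply, h, smul_add]
    · simp only [Pi.add_apply, WithLp.ofLp_add, Matrix.mulVec_add]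
      rw [add_add_add_comm, B₁, B₂, add_zero]
    · filter_upwards [ha₂, E₁, E₂] with ζ h e₁ e₂
      simp only [Prod.snd_add, Pi.neg_apply, Pi.add_apply, h, e₁, e₂]
      abel
  smul_mem' := by
    rintro c p ⟨h, k, H, B, E⟩
    have ha₁ := (unitMeasure_absolutelyContinuous hlam).ae_le (Lp.coeFn_smul c p.1)
    have ha₂ := (unitMeasure_absolutelyContinuous hlam).ae_le (Lp.coeFn_smul c p.2)
    refine ⟨c • h, c • k, (H.const_smul c).congr ?_, ?_, ?_⟩
    · filter_upwards [ha₁] with ζ h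
      simp only [Prod.smul_fst, Pi.smul_apply, h]
      exact smul_comm _ _ _
    · simp only [Pi.smul_apply, WithLp.ofLp_smul, Matrix.mulVec_smul]
      rw [← smul_add, B, smul_zero]
    · filter_upwards [ha₂, E] with ζ h e
      simp only [Prod.smul_snd, Pi.neg_apply, Pi.smul_apply, h, e, smul_neg]

theorem transportGraph_singleValued {n : ℕ} {lam : ℝ → ℝ} (hlam : IsSpeed lam)
    (M : ℝ → Matrix (Fin n) (Fin n) ℂ) (K L : Matrix (Fin n) (Fin n) ℂ)
    (p : StateSpace n lam × StateSpace n lam) (hp : p ∈ transportGraph hlam M K L)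
    (hp0 : p.1 = 0) : p.2 = 0 := by
  obtain ⟨h, k, H, -, E⟩ := hp
  have hz := (unitMeasure_absolutelyContinuous hlam).ae_le
    (Lp.coeFn_zero (EuclideanSpace ℂ (Fin n)) 2 (weightedMeasure lam))
  have hk := H.deriv_ae_eq_zero (by
    rw [hp0]
    filter_upwards [hz] with ζ h
    rw [h]
    simp)
  refine (Lp.eq_zero_iff_ae_eq_zero).2
    ((withDensity_absolutelyContinuous unitMeasure _).ae_le ?_)
  filter_upwards [E, hk] with ζ e h
  simp [e, h]

/-- The transport operator `𝔄 g = -(lam g)'` on `X` with domain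
`{g ∈ X | lam g ∈ H¹(0,1;ℂⁿ), lam(0) K g(0) + lam(1) L P(1) g(1) = 0}`. -/
noncomputable def transportOperator {n : ℕ} {lam : ℝ → ℝ} (hlam : IsSpeed lam)
    (M : ℝ → Matrix (Fin n) (Fin n) ℂ) (K L : Matrix (Fin n) (Fin n) ℂ) :
    StateSpace n lam →ₗ.[ℂ] StateSpace n lam :=
  (transportGraph hlam M K L).toLinearPMap

theorem transportOperator_graph {n : ℕ} {lam : ℝ → ℝ} (hlam : IsSpeed lam)
    (M : ℝ → Matrix (Fin n) (Fin n) ℂ) (K L : Matrix (Fin n) (Fin n) ℂ) :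
    (transportOperator hlam M K L).graph = transportGraph hlam M K L :=
  Submodule.toLinearPMap_graph_eq _ (transportGraph_singleValued hlam M K L)

theorem MeasureTheory.MemLp.weighted {n : ℕ} {lam : ℝ → ℝ} (hlam : IsSpeed lam)
    {f : ℝ → EuclideanSpace ℂ (Fin n)} (hf : MemLp f 2 unitMeasure) :
    MemLp f 2 (weightedMeasure lam) := by
  refine hf.of_measure_le_smul (c := eLpNorm lam ∞ unitMeasure) hlam.memLp.2.ne ?_
  rw [← withDensity_const]
  refine withDensity_mono ?_
  filter_upwards [ae_le_eLpNormEssSup (f := lam) (μ := unitMeasure)] with s hs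
  rw [eLpNorm_exponent_top]
  exact (Real.ofReal_le_enorm _).trans hs

/-- The domain of the transport operator. -/
theorem mem_transportOperator_domain {n : ℕ} {lam : ℝ → ℝ} (hlam : IsSpeed lam)
    (M : ℝ → Matrix (Fin n) (Fin n) ℂ) (K L : Matrix (Fin n) (Fin n) ℂ) (g : StateSpace n lam) :
    g ∈ (transportOperator hlam M K L).domain ↔
      ∃ h h' : ℝ → EuclideanSpace ℂ (Fin n),
        IsH1With (fun ζ => ((lam ζ : ℝ) : ℂ) • g ζ) h h' ∧
        K *ᵥ (h 0).ofLp + (L * fundamentalMatrix lam M 1) *ᵥ (h 1).ofLp = 0 := by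
  constructor
  · rintro ⟨p, ⟨h, h', H, B, -⟩, rfl⟩
    exact ⟨h, h', H, B⟩
  · rintro ⟨h, h', H, B⟩
    have hm := H.memLp.neg.weighted hlam
    exact ⟨(g, hm.toLp _), ⟨h, h', H, B,
      (unitMeasure_absolutelyContinuous hlam).ae_le hm.coeFn_toLp⟩, rfl⟩

/-! ### Strongly continuous semigroups -/

namespace C0Semigroup

variable {X : Type*} [NormedAddCommGroup X] [NormedSpace ℂ X] (T : C0Semigroup X)

/-! Put `τ(ζ) = ∫₀^ζ lam⁻¹` and `T = τ(1)`. Sending `g` to the flux `lam g`, read as a function of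
the travel time, is an isometry of the state space onto `L²(0, T; ℂⁿ)`, because `|lam g|² lam⁻¹ =
lam |g|²`. It turns the operator into `-d/ds` with boundary condition `K x(0) + Q x(T) = 0`, where
`Q = L P(1)` (`mem_transportGraph_iff`). Only the matrices `K` and `Q` are left, and the nature of
`Q` plays no role.

If `K` is invertible, the condition reads `x(0) = B x(T)` with `B = -K⁻¹ Q`: what flows out at `T`
is fed back at `0`. The solution is explicit: extend `x` to the left by `x(s) = B x(s + T)` and
translate to the right (`translationSemigroup`). For `x` in the domain this extension is a
primitive, its difference quotients are averages of an `L²` function, and these converge in `L²`; so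
the generator extends the operator. The two agree because, for large `a`, `a` minus the operator is
onto, while `a` is not an eigenvalue of the generator (`inGenerator_iff_of_subset`).

If `K` is singular, choose a row vector `u ≠ 0` with `u K = 0`. If also `u Q = 0`, then `K + z Q` is
singular for every `z`; taking `z = exp(-aT)` yields an eigenfunction `exp(-as) c` for every real
`a`, whereas a semigroup forces `exp a ≤ ‖S(1)‖` for its real eigenvalues. If `u Q ≠ 0`, every `x`
in the domain satisfies `u Q x(T) = 0`, a constraint on the outflow, which the interior has already
determined. Put `β = (u Q)^*` and test an orbit `x(t)` against `max(s - t, 0)² β`, a profile carried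
along with the flow: the pairing is constant in `t`, it vanishes at `t = T`, and it is nonzero at `t
= 0` for `x(s) = s (T - s) β`. -/

theorem op_add_apply (s t : ℝ≥0) (x : X) : T.op (s + t) x = T.op s (T.op t x) := by
  rw [T.op_add]; rfl

theorem tendsto_op_zero (x : X) : Tendsto (fun t : ℝ≥0 => T.op t x) (𝓝 0) (𝓝 x) := by
  have h : 𝓝 (0 : ℝ≥0) = pure 0 ⊔ 𝓝[>] 0 := by
    rw [← nhdsWithin_univ, ← Ici_bot, bot_eq_zero, ← Ioi_insert, nhdsWithin_insert]
  rw [h, tendsto_sup]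
  refine ⟨?_, T.strongly_continuous x⟩
  rw [tendsto_pure_left]
  intro s hs
  rw [T.op_zero]
  exact mem_of_mem_nhds hs

/-- Otherwise some sequence `tₙ → 0` has `‖T(tₙ)‖ > n` although every orbit converges along it,
against Banach–Steinhaus. -/
theorem exists_bound_near_zero [CompleteSpace X] : ∃ δ : ℝ≥0, 0 < δ ∧ ∃ C : ℝ, ∀ t ≤ δ, ‖T.op t‖ ≤ C := by
  by_contra! hcon
  choose t ht hn using fun n : ℕ => hcon (1 / ((n : ℝ≥0) + 1)) (by positivity) n
  have ht0 : Tendsto t atTop (𝓝 0) :=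
    tendsto_of_tendsto_of_tendsto_of_le_of_le tendsto_const_nhds
      tendsto_one_div_add_atTop_nhds_zero_nat (fun _ => zero_le) ht
  obtain ⟨C, hC⟩ := banach_steinhaus (g := fun n => T.op (t n)) fun x => by
    obtain ⟨C, hC⟩ := ((T.tendsto_op_zero x).comp ht0).norm.bddAbove_range
    exact ⟨C, fun n => hC ⟨n, rfl⟩⟩
  obtain ⟨n, hn'⟩ := exists_nat_gt C
  exact absurd (hC n) (not_le.2 (hn'.trans (hn n)))

/-- Factoring out the smaller time gives `T(t)x - T(t₀)x = ± T(min t t₀)(T(|t - t₀|)x - x)`, so left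
and right continuity are handled together once `T(min t t₀)` is bounded near `t₀`. -/
theorem continuous_orbit [CompleteSpace X] (x : X) : Continuous fun t : ℝ≥0 => T.op t x := by
  obtain ⟨δ, hδ, C, hC⟩ := T.exists_bound_near_zero
  rw [continuous_iff_continuousAt]
  intro t₀
  have hC0 : 0 ≤ C := (norm_nonneg _).trans (hC 0 zero_le)
  rw [ContinuousAt, tendsto_iff_norm_sub_tendsto_zero]
  have hlim : Tendsto (fun t : ℝ≥0 => ‖T.op (t₀ - δ)‖ * C * ‖T.op (nndist t t₀) x - x‖)
      (𝓝 t₀) (𝓝 0) := by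
    have h1 : Tendsto (fun t : ℝ≥0 => nndist t t₀) (𝓝 t₀) (𝓝 0) := by
      have : Continuous fun t : ℝ≥0 => nndist t t₀ := by fun_prop
      simpa using this.tendsto t₀
    have h2 := ((T.tendsto_op_zero x).comp h1).sub_const x
    have h3 := h2.norm.const_mul (‖T.op (t₀ - δ)‖ * C)
    simpa using h3
  refine squeeze_zero' (.of_forall fun _ => norm_nonneg _) ?_ hlim
  have hmem : ∀ᶠ t in 𝓝 t₀, t₀ - δ ≤ t := by
    rcases le_or_gt t₀ δ with h | h
    · simp [tsub_eq_zero_of_le h]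
    · exact (eventually_gt_nhds (tsub_lt_self (hδ.trans h) hδ)).mono fun _ h => h.le
  filter_upwards [hmem] with t ht
  -- The smaller time is `t₀ - δ` (truncated at `0`) plus a remainder of at most `δ`, where the
  -- local bound `C` applies.
  have hm : ‖T.op (min t t₀)‖ ≤ ‖T.op (t₀ - δ)‖ * C := by
    have h1 : t₀ - δ ≤ min t t₀ := le_min ht tsub_le_self
    rw [← add_tsub_cancel_of_le h1, T.op_add]
    refine (ContinuousLinearMap.opNorm_comp_le _ _).trans ?_
    gcongr
    refine hC _ (tsub_le_iff_left.2 ((min_le_right _ _).trans ?_))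
    exact le_tsub_add
  have hd : ∀ a b : ℝ≥0, a ≤ b → b = a + nndist b a := by
    intro a b hab
    ext
    rw [NNReal.coe_add, coe_nndist, NNReal.dist_eq, abs_of_nonneg (by simpa using hab)]
    ring
  have key : ‖T.op t x - T.op t₀ x‖ = ‖T.op (min t t₀) (T.op (nndist t t₀) x - x)‖ := by
    rcases le_total t t₀ with h | h
    · rw [min_eq_left h, map_sub, ← T.op_add_apply, nndist_comm, ← hd t t₀ h, norm_sub_rev]
    · rw [min_eq_right h, map_sub, ← T.op_add_apply, ← hd t₀ t h]
  rw [key]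
  exact (ContinuousLinearMap.le_opNorm _ _).trans (by gcongr)

/-- The pair `(x, y)` belongs to the graph of the generator of `T`. -/
def InGenerator (x y : X) : Prop :=
  Tendsto (fun t : ℝ≥0 => (((t : ℝ) : ℂ)⁻¹) • (T.op t x - x)) (𝓝[>] 0) (𝓝 y)

variable {T}

theorem InGenerator.op {x y : X} (h : T.InGenerator x y) (t : ℝ≥0) :
    T.InGenerator (T.op t x) (T.op t y) := by
  refine (((T.op t).continuous.tendsto y).comp h).congr fun s => ?_
  simp only [Function.comp, map_smul, map_sub, ← T.op_add_apply, add_comm s t]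

/-- The right derivative is all that is needed later: a continuous function with vanishing right
derivative is constant. -/
theorem InGenerator.hasDerivWithinAt {x y : X} (h : T.InGenerator x y) {t : ℝ} (ht : 0 ≤ t) :
    HasDerivWithinAt (fun r : ℝ => T.op r.toNNReal x) (T.op t.toNNReal y) (Ici t) t := by
  rw [hasDerivWithinAt_iff_tendsto_slope, Ici_sdiff_left]
  have h1 : Tendsto (fun r : ℝ => (r - t).toNNReal) (𝓝[>] t) (𝓝[>] 0) := by
    refine tendsto_nhdsWithin_iff.2 ⟨?_, ?_⟩
    · have : Continuous fun r : ℝ => (r - t).toNNReal := by fun_prop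
      simpa using (this.tendsto t).mono_left nhdsWithin_le_nhds
    · filter_upwards [self_mem_nhdsWithin] with r hr
      simpa using hr
  refine ((h.op t.toNNReal).comp h1).congr' ?_
  filter_upwards [self_mem_nhdsWithin] with r hr
  have hr' : (0 : ℝ) ≤ r - t := sub_nonneg.2 (le_of_lt hr)
  simp only [Function.comp, slope, vsub_eq_sub]
  rw [← T.op_add_apply, ← Real.toNNReal_add hr' ht, sub_add_cancel, Real.coe_toNNReal _ hr',
    ← Complex.ofReal_inv, Complex.coe_smul]

theorem continuous_orbit_real [CompleteSpace X] (x : X) : Continuous fun r : ℝ => T.op r.toNNReal x :=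
  (T.continuous_orbit x).comp continuous_real_toNNReal

/-- Eigenvectors of the generator evolve exponentially. -/
theorem InGenerator.op_eq_exp [CompleteSpace X] {x : X} {a : ℝ} (h : T.InGenerator x ((a : ℂ) • x)) (t : ℝ≥0) :
    T.op t x = Real.exp (a * t) • x := by
  have hder : ∀ r ∈ Ico (0 : ℝ) t, HasDerivWithinAt
      (fun r : ℝ => Real.exp (-(a * r)) • T.op r.toNNReal x) 0 (Ici r) r := by
    intro r hr
    have h1 : HasDerivAt (fun r : ℝ => Real.exp (-(a * r))) (Real.exp (-(a * r)) * -(a * 1)) r :=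
      ((hasDerivAt_id r).const_mul a).neg.exp
    have h2 := h1.hasDerivWithinAt.smul (h.hasDerivWithinAt hr.1) (s := Ici r)
    convert! h2 using 1
    rw [map_smul, Complex.coe_smul, smul_smul, ← add_smul]
    ring_nf
    simp
  have hconst := constant_of_has_deriv_right_zero
    (Continuous.continuousOn (by have := T.continuous_orbit_real x; fun_prop)) hder t
    (right_mem_Icc.2 t.2)
  simp only [Real.toNNReal_coe, mul_zero, neg_zero, Real.exp_zero, one_smul, Real.toNNReal_zero,
    T.op_zero, ContinuousLinearMap.id_apply] at hconst
  nth_rw 2 [← hconst]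
  rw [smul_smul, ← Real.exp_add]
  simp

/-- At time `1` an eigenvector gives `exp a * ‖x‖ ≤ ‖T(1)‖ * ‖x‖`. The norm at one time thus
replaces an exponential growth bound. -/
theorem InGenerator.eq_zero_of_norm_lt [CompleteSpace X] {x : X} {a : ℝ} (h : T.InGenerator x ((a : ℂ) • x))
    (ha : ‖T.op 1‖ < Real.exp a) : x = 0 := by
  by_contra hx
  have h1 := (T.op 1).le_opNorm x
  rw [h.op_eq_exp, norm_smul, Real.norm_of_nonneg (Real.exp_pos _).le] at h1
  have h2 : ‖T.op 1‖ * ‖x‖ < Real.exp a * ‖x‖ :=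
    mul_lt_mul_of_pos_right ha (norm_pos_iff.2 hx)
  simp only [NNReal.coe_one, mul_one] at h1
  exact absurd h1 (not_le.2 h2)

theorem InGenerator.sub {x y x' y' : X} (h : T.InGenerator x y) (h' : T.InGenerator x' y') :
    T.InGenerator (x - x') (y - y') := by
  refine (Tendsto.sub h h').congr fun t => ?_
  rw [← smul_sub, map_sub]
  congr 1
  abel

/-- A relation contained in the generator whose resolvent range is everything for some large `a`
is the generator. -/
theorem inGenerator_iff_of_subset [CompleteSpace X] {R : Set (X × X)}
    (hsub : ∀ p ∈ R, T.InGenerator p.1 p.2) {a : ℝ} (ha : ‖T.op 1‖ < Real.exp a)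
    (hsurj : ∀ f : X, ∃ p ∈ R, (a : ℂ) • p.1 - p.2 = f) (x y : X) :
    (x, y) ∈ R ↔ T.InGenerator x y := by
  refine ⟨fun h => hsub _ h, fun h => ?_⟩
  -- A pair of `R` with the same value of `a x - y`; the difference of the two pairs is an
  -- eigenvector for `a`, hence zero.
  obtain ⟨⟨x', y'⟩, hp, hf⟩ := hsurj ((a : ℂ) • x - y)
  have h1 : y - y' = (a : ℂ) • (x - x') := by
    rw [smul_sub]
    simp only at hf
    rw [← sub_eq_zero]
    rw [← sub_eq_zero] at hf
    rw [← hf]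
    abel
  have h2 := h.sub (hsub _ hp)
  simp only [h1] at h2
  have h3 := sub_eq_zero.1 (h2.eq_zero_of_norm_lt ha)
  rw [h3, sub_self, smul_zero, sub_eq_zero] at h1
  rwa [h3, h1]

end C0Semigroup

/-- Conjugation of a `C₀`-semigroup with an isomorphism. -/
def C0Semigroup.conj {X Y : Type*} [NormedAddCommGroup X] [NormedSpace ℂ X]
    [NormedAddCommGroup Y] [NormedSpace ℂ Y] (T : C0Semigroup X) (Φ : X ≃L[ℂ] Y) :
    C0Semigroup Y where
  op t := (Φ : X →L[ℂ] Y).comp ((T.op t).comp (Φ.symm : Y →L[ℂ] X))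
  op_zero := by ext y; simp [T.op_zero]
  op_add s t := by ext y; simp [T.op_add_apply]
  strongly_continuous y := by
    have := (Φ.continuous.tendsto _).comp (T.strongly_continuous (Φ.symm y))
    simpa [Function.comp_def] using this

theorem C0Semigroup.conj_inGenerator {X Y : Type*} [NormedAddCommGroup X] [NormedSpace ℂ X]
    [NormedAddCommGroup Y] [NormedSpace ℂ Y] (T : C0Semigroup X) (Φ : X ≃L[ℂ] Y) (x y : X) :
    (T.conj Φ).InGenerator (Φ x) (Φ y) ↔ T.InGenerator x y := by
  have h : (fun t : ℝ≥0 => (((t : ℝ) : ℂ)⁻¹) • ((T.conj Φ).op t (Φ x) - Φ x)) =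
      Φ ∘ fun t : ℝ≥0 => (((t : ℝ) : ℂ)⁻¹) • (T.op t x - x) := by
    funext t
    simp [C0Semigroup.conj]
  rw [InGenerator, InGenerator, h]
  exact Φ.toHomeomorph.isInducing.tendsto_nhds_iff.symm

/-- Being a generator is invariant under isomorphisms of the state space. -/
theorem generatesC0Semigroup_iff_of_equiv {X Y : Type*} [NormedAddCommGroup X] [NormedSpace ℂ X]
    [NormedAddCommGroup Y] [NormedSpace ℂ Y] (A : X →ₗ.[ℂ] X) (Φ : X ≃L[ℂ] Y) (R : Set (Y × Y))
    (hR : ∀ x y, (x, y) ∈ A.graph ↔ (Φ x, Φ y) ∈ R) :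
    GeneratesC0Semigroup A ↔ ∃ T : C0Semigroup Y, ∀ x y, (x, y) ∈ R ↔ T.InGenerator x y := by
  constructor
  · rintro ⟨T, hT⟩
    refine ⟨T.conj Φ, fun x y => ?_⟩
    have h1 := hR (Φ.symm x) (Φ.symm y)
    have h2 := T.conj_inGenerator Φ (Φ.symm x) (Φ.symm y)
    simp only [Φ.apply_symm_apply] at h1 h2
    rw [← h1, h2]
    exact hT _ _
  · rintro ⟨T, hT⟩
    refine ⟨T.conj Φ.symm, fun x y => ?_⟩
    have h2 := T.conj_inGenerator Φ.symm (Φ x) (Φ y)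
    simp only [Φ.symm_apply_apply] at h2
    rw [hR, hT]
    exact h2.symm

/-! ### Primitives, translations and averages -/

section Primitives

variable {E : Type*} [NormedAddCommGroup E] [NormedSpace ℝ E]

/-- Increments of the primitive are dominated by those of the primitive of `‖g‖`, which reduces the
claim to real functions. -/
theorem IntervalIntegrable.absolutelyContinuousOnInterval_primitive {g : ℝ → E} {a b c : ℝ}
    (hg : IntervalIntegrable g volume a b) (hc : c ∈ uIcc a b) :
    AbsolutelyContinuousOnInterval (fun x => ∫ r in c..x, g r) a b := by
  have hn := hg.norm.absolutelyContinuousOnInterval_intervalIntegral hc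
  have hsub : ∀ x ∈ uIcc a b, IntervalIntegrable g volume c x := fun x hx =>
    hg.mono_set (uIcc_subset_uIcc hc hx)
  refine squeeze_zero' (.of_forall fun _ => Finset.sum_nonneg fun _ _ => dist_nonneg) ?_ hn
  refine (eventually_inf_principal.2 (.of_forall fun I hI => ?_))
  refine Finset.sum_le_sum fun i hi => ?_
  have hm := hI.1 i hi
  have h1 := hsub _ hm.1
  have h2 := hsub _ hm.2
  rw [dist_eq_norm, Real.dist_eq, intervalIntegral.integral_interval_sub_left h1 h2,
    intervalIntegral.integral_interval_sub_left h1.norm h2.norm]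
  exact intervalIntegral.norm_integral_le_abs_integral_norm

/-- Integration by parts against a primitive. -/
theorem integral_smul_eq_sub_integral_deriv_smul_primitive [CompleteSpace E] {φ φ' : ℝ → ℝ}
    (hφ : ∀ r, HasDerivAt φ (φ' r) r) (hφ' : Continuous φ') {g : ℝ → E} {b : ℝ}
    (hg : IntervalIntegrable g volume 0 b) :
    ∫ r in (0 : ℝ)..b, φ r • g r =
      φ b • (∫ r in (0 : ℝ)..b, g r) - ∫ r in (0 : ℝ)..b, φ' r • ∫ u in (0 : ℝ)..r, g u := by
  have hφc : Continuous φ := continuous_iff_continuousAt.2 fun r => (hφ r).continuousAt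
  have hG := hg.absolutelyContinuousOnInterval_primitive (left_mem_uIcc (a := 0) (b := b))
  have hφG : IntervalIntegrable (fun r => φ' r • ∫ u in (0 : ℝ)..r, g u) volume 0 b :=
    (hφ'.continuousOn.smul hG.continuousOn).intervalIntegrable
  have hφg : IntervalIntegrable (fun r => φ r • g r) volume 0 b :=
    hg.continuousOn_smul hφc.continuousOn
  have hsum := hφg.add hφG
  have hφac : AbsolutelyContinuousOnInterval φ 0 b := by
    refine ContDiffOn.absolutelyContinuousOnInterval (ContDiff.contDiffOn ?_)
    refine contDiff_one_iff_deriv.2 ⟨fun r => (hφ r).differentiableAt, ?_⟩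
    rwa [show deriv φ = φ' from funext fun r => (hφ r).deriv]
  -- With `G` the primitive of `g`, the function `φ G - ∫ (φ g + φ' G)` is absolutely continuous
  -- with zero derivative almost everywhere, hence constant.
  obtain ⟨C, hC⟩ := ((hφac.fun_smul hG).sub
    (hsum.absolutelyContinuousOnInterval_primitive left_mem_uIcc)).const_of_ae_hasDerivAt_zero (by
      filter_upwards [hg.ae_hasDerivAt_integral, hsum.ae_hasDerivAt_integral] with r h1 h2 hr
      have := ((hφ r).smul (h1 hr 0 left_mem_uIcc)).sub (h2 hr 0 left_mem_uIcc)
      convert! this using 1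
      simp)
  have h0 := hC 0 left_mem_uIcc
  have h1 := hC b right_mem_uIcc
  rw [← h0] at h1
  simp only [Pi.sub_apply, intervalIntegral.integral_same, smul_zero, sub_zero] at h1
  rw [intervalIntegral.integral_add hφg hφG] at h1
  rw [sub_eq_zero] at h1
  rw [h1]
  abel

end Primitives

/-! ### Translates and averages in `L²(ℝ)` -/

section Averages

variable {E : Type*} [NormedAddCommGroup E]

theorem eLpNorm_two_sq {α : Type*} [MeasurableSpace α] (f : α → E) (μ : Measure α) :
    eLpNorm f 2 μ ^ 2 = ∫⁻ s, ‖f s‖ₑ ^ 2 ∂μ := by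
  have := eLpNorm_nnreal_pow_eq_lintegral (f := f) (μ := μ) (p := 2) (by norm_num)
  simpa using this

theorem tendsto_eLpNorm_two_iff {α ι : Type*} [MeasurableSpace α] {μ : Measure α} {l : Filter ι}
    (f : ι → α → E) :
    Tendsto (fun i => eLpNorm (f i) 2 μ) l (𝓝 0) ↔
      Tendsto (fun i => ∫⁻ s, ‖f i s‖ₑ ^ 2 ∂μ) l (𝓝 0) := by
  simp_rw [← eLpNorm_two_sq]
  constructor
  · intro h
    simpa using ENNReal.Tendsto.pow (n := 2) h
  · intro h
    have h1 := (ENNReal.continuous_rpow_const (y := 2⁻¹)).tendsto 0 |>.comp h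
    rw [ENNReal.zero_rpow_of_pos (by norm_num)] at h1
    refine h1.congr fun i => ?_
    simp only [Function.comp]
    rw [← ENNReal.rpow_natCast, ← ENNReal.rpow_mul]
    norm_num

/-- Translations are continuous in `L²(ℝ)`. -/
theorem tendsto_eLpNorm_translate_sub {v : ℝ → E} (hv : MemLp v 2 volume) :
    Tendsto (fun t : ℝ => eLpNorm (fun s => v (s - t) - v s) 2 volume) (𝓝 0) (𝓝 0) := by
  -- Currying makes the translation depend continuously on `t` in the compact-open topology, as
  -- continuity of composition on `Lp` requires.
  let g : C(ℝ, C(ℝ, ℝ)) := (ContinuousMap.mk (fun p : ℝ × ℝ => p.2 - p.1) (by fun_prop)).curry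
  have hgm : ∀ t, MeasurePreserving (g t) volume volume := fun t =>
    measurePreserving_sub_right volume t
  have h := (tendsto_const_nhds (x := hv.toLp v)).compMeasurePreservingLp (g.continuous.tendsto 0)
    hgm (hgm 0) (by norm_num)
  have h2 := (Lp.tendsto_Lp_iff_tendsto_eLpNorm' _ _).1 h
  refine h2.congr fun t => eLpNorm_congr_ae ?_
  have h3 : ∀ t, (Lp.compMeasurePreserving (g t) (hgm t) (hv.toLp v)) =ᵐ[volume]
      fun s => v (s - t) := fun t =>
    (Lp.coeFn_compMeasurePreserving _ (hgm t)).trans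
      ((hgm t).quasiMeasurePreserving.ae_eq_comp hv.coeFn_toLp)
  filter_upwards [h3 t, h3 0] with s h4 h5
  simp only [Pi.sub_apply, h4, h5, sub_zero]

/-- Cauchy–Schwarz against the constant `1`. -/
theorem sq_lintegral_Ioc_le {f : ℝ → ℝ≥0∞} (hf : Measurable f) {t : ℝ} :
    (∫⁻ r in Ioc 0 t, f r) ^ 2 ≤ ENNReal.ofReal t * ∫⁻ r in Ioc 0 t, f r ^ 2 := by
  have h := ENNReal.lintegral_mul_le_Lp_mul_Lq (volume.restrict (Ioc 0 t))
    Real.HolderConjugate.two_two (f := fun _ => 1) (g := f) aemeasurable_const hf.aemeasurable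
  simp only [Pi.mul_apply, one_mul, lintegral_const, Measure.restrict_apply_univ,
    Real.volume_Ioc, sub_zero, ENNReal.rpow_two, one_pow] at h
  refine (pow_le_pow_left' h 2).trans (le_of_eq ?_)
  rw [mul_pow, ← ENNReal.rpow_mul_natCast, ← ENNReal.rpow_mul_natCast]
  norm_num

/-- The averages over `[s - t, s]` of an `L²` function converge to it in `L²`. -/
theorem tendsto_eLpNorm_average_sub [NormedSpace ℝ E] [CompleteSpace E] {v : ℝ → E}
    (hvm : StronglyMeasurable v) (hv : MemLp v 2 volume) :
    Tendsto (fun t : ℝ => eLpNorm (fun s => t⁻¹ • (∫ r in (s - t)..s, v r) - v s) 2 volume)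
      (𝓝[>] 0) (𝓝 0) := by
  have hN := (tendsto_eLpNorm_two_iff _).1 (tendsto_eLpNorm_translate_sub hv)
  rw [tendsto_eLpNorm_two_iff, ENNReal.tendsto_nhds_zero]
  intro ε hε
  obtain ⟨δ, hδ, hδN⟩ := Metric.eventually_nhds_iff.1 (ENNReal.tendsto_nhds_zero.1 hN ε hε)
  filter_upwards [Ioo_mem_nhdsGT hδ] with t ht
  have ht0 : 0 < t := ht.1
  have hmeas : Measurable (fun p : ℝ × ℝ => ‖v (p.1 - p.2) - v p.1‖ₑ) :=
    ((hvm.comp_measurable (by fun_prop : Measurable fun p : ℝ × ℝ => p.1 - p.2)).sub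
      (hvm.comp_measurable measurable_fst)).enorm
  have hint : ∀ a b : ℝ, IntervalIntegrable v volume a b := fun a b =>
    ((hv.locallyIntegrable (by norm_num)).integrableOn_isCompact isCompact_uIcc).intervalIntegrable
  -- An average minus `v(s)` is the average of `v(s - r) - v(s)` over `0 < r ≤ t`. After squaring,
  -- Tonelli leaves an average of squared translation errors, each at most `ε`.
  have hpt : ∀ s, ‖t⁻¹ • (∫ r in (s - t)..s, v r) - v s‖ₑ ^ 2 ≤
      ENNReal.ofReal t⁻¹ * ∫⁻ r in Ioc 0 t, ‖v (s - r) - v s‖ₑ ^ 2 := by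
    intro s
    have hi : IntervalIntegrable (fun r => v (s - r)) volume 0 t := by
      simpa using (hint s (s - t)).comp_sub_left s
    have h1 : t⁻¹ • (∫ r in (s - t)..s, v r) - v s =
        t⁻¹ • ∫ r in (0 : ℝ)..t, (v (s - r) - v s) := by
      rw [intervalIntegral.integral_sub hi intervalIntegrable_const,
        intervalIntegral.integral_comp_sub_left (fun r => v r), intervalIntegral.integral_const,
        smul_sub, sub_zero, sub_zero, smul_smul, inv_mul_cancel₀ ht0.ne', one_smul]
    rw [h1, enorm_smul, mul_pow, intervalIntegral.integral_of_le ht0.le]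
    refine (mul_le_mul_right (pow_le_pow_left' (enorm_integral_le_lintegral_enorm _) 2) _).trans ?_
    refine (mul_le_mul_right (sq_lintegral_Ioc_le
      (hmeas.comp (measurable_const.prodMk measurable_id))) _).trans (le_of_eq ?_)
    have h2 : ‖t⁻¹‖ₑ = ENNReal.ofReal t⁻¹ := Real.enorm_of_nonneg (by positivity)
    rw [h2, ← mul_assoc]
    congr 1
    rw [← ENNReal.ofReal_pow (by positivity), ← ENNReal.ofReal_mul (by positivity)]
    congr 1
    field_simp
  calc ∫⁻ s, ‖t⁻¹ • (∫ r in (s - t)..s, v r) - v s‖ₑ ^ 2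
      ≤ ∫⁻ s, ENNReal.ofReal t⁻¹ * ∫⁻ r in Ioc 0 t, ‖v (s - r) - v s‖ₑ ^ 2 := lintegral_mono hpt
    _ = ENNReal.ofReal t⁻¹ * ∫⁻ s, ∫⁻ r in Ioc 0 t, ‖v (s - r) - v s‖ₑ ^ 2 :=
        lintegral_const_mul' _ _ ENNReal.ofReal_ne_top
    _ = ENNReal.ofReal t⁻¹ * ∫⁻ r in Ioc 0 t, ∫⁻ s, ‖v (s - r) - v s‖ₑ ^ 2 := by
        rw [lintegral_lintegral_swap]
        exact (hmeas.pow_const 2).aemeasurable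
    _ ≤ ENNReal.ofReal t⁻¹ * ∫⁻ _ in Ioc 0 t, ε := by
        refine mul_le_mul_right ?_ _
        refine setLIntegral_mono measurable_const fun r hr => hδN ?_
        rw [Real.dist_eq, sub_zero, abs_of_pos hr.1]
        exact hr.2.trans_lt ht.2
    _ = ε := by
        rw [setLIntegral_const, Real.volume_Ioc, sub_zero, mul_left_comm,
          ← ENNReal.ofReal_mul (by positivity), inv_mul_cancel₀ ht0.ne', ENNReal.ofReal_one,
          mul_one]

end Averages

/-! ### The transport equation of unit speed on an interval -/

section QuasiPeriodic

variable {E : Type*} [NormedAddCommGroup E] [NormedSpace ℂ E]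

/-- The extension of a function `w` on `[0, T)` to `(-∞, T)` that satisfies `w(s) = B w(s + T)`. -/
noncomputable def quasiPeriodicExt (B : E →L[ℂ] E) (T : ℝ) (w : ℝ → E) (s : ℝ) : E :=
  (B ^ ⌈-s / T⌉₊) (w (s + ⌈-s / T⌉₊ * T))

variable {B : E →L[ℂ] E} {T : ℝ}

theorem quasiPeriodicExt_of_nonneg (hT : 0 < T) (w : ℝ → E) {s : ℝ} (hs : 0 ≤ s) :
    quasiPeriodicExt B T w s = w s := by
  have : ⌈-s / T⌉₊ = 0 := Nat.ceil_eq_zero.2 (div_nonpos_of_nonpos_of_nonneg (by linarith) hT.le)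
  simp [quasiPeriodicExt, this]

theorem quasiPeriodicExt_of_neg (hT : 0 < T) (w : ℝ → E) {s : ℝ} (hs : s < 0) :
    quasiPeriodicExt B T w s = B (quasiPeriodicExt B T w (s + T)) := by
  have h1 : -s / T = -(s + T) / T + 1 := by field_simp; ring
  have h2 : ⌈-s / T⌉₊ = ⌈-(s + T) / T⌉₊ + 1 := by
    have h0 : 0 < -s / T := div_pos (by linarith) hT
    -- For `-T < s < 0` the natural ceiling of the negative number `-(s + T) / T` is truncated to
    -- `0`, while that of `-s / T` is `1`.
    rcases le_or_gt 0 (-(s + T) / T) with h | h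
    · rw [h1, Nat.ceil_add_one h]
    · rw [Nat.ceil_eq_zero.2 h.le, zero_add, Nat.ceil_eq_iff one_ne_zero]
      norm_num
      exact ⟨h0, by linarith⟩
  rw [quasiPeriodicExt, quasiPeriodicExt, h2, pow_succ']
  simp only [mul_apply_eq_comp]
  congr 3
  push_cast
  ring

theorem quasiPeriodicExt_eq_pow (hT : 0 < T) (w : ℝ → E) {s : ℝ} (j : ℕ) (hs : s + j * T < T) :
    quasiPeriodicExt B T w s = (B ^ j) (quasiPeriodicExt B T w (s + j * T)) := by
  induction j with
  | zero => simp
  | succ j ih =>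
    push_cast at hs
    rw [ih (by linarith), quasiPeriodicExt_of_neg hT w (s := s + j * T) (by linarith), pow_succ]
    simp only [mul_apply_eq_comp]
    congr 3
    push_cast
    ring

theorem add_ceil_mul_nonneg (hT : 0 < T) (s : ℝ) : 0 ≤ s + ⌈-s / T⌉₊ * T := by
  have := (div_le_iff₀ hT).1 (Nat.le_ceil (-s / T))
  linarith

theorem add_ceil_mul_lt (hT : 0 < T) {s : ℝ} (hs : s < T) : s + ⌈-s / T⌉₊ * T < T := by
  rcases le_or_gt 0 s with h | h
  · rw [Nat.ceil_eq_zero.2 (div_nonpos_of_nonpos_of_nonneg (by linarith) hT.le)]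
    simpa
  · have h0 : 0 < -s / T := div_pos (by linarith) hT
    have h1 := Nat.ceil_lt_add_one h0.le
    have h2 := mul_lt_mul_of_pos_right h1 hT
    rw [add_mul, div_mul_cancel₀ _ hT.ne'] at h2
    linarith

/-- Extending a translated extension returns that same translate, because the relation `w(s) = B w(s
+ T)` is translation invariant. This is the semigroup law. -/
theorem quasiPeriodicExt_translate (hT : 0 < T) (w : ℝ → E) {t : ℝ} (ht : 0 ≤ t) {s : ℝ}
    (hs : s < T) : quasiPeriodicExt B T (fun r => quasiPeriodicExt B T w (r - t)) s =
      quasiPeriodicExt B T w (s - t) := by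
  have h := add_ceil_mul_lt hT hs
  rw [quasiPeriodicExt_eq_pow hT w (s := s - t) ⌈-s / T⌉₊ (by linarith)]
  rw [quasiPeriodicExt]
  congr 2
  ring

theorem quasiPeriodicExt_add (w w' : ℝ → E) :
    quasiPeriodicExt B T (w + w') = quasiPeriodicExt B T w + quasiPeriodicExt B T w' := by
  funext s
  simp [quasiPeriodicExt]

theorem quasiPeriodicExt_smul (c : ℂ) (w : ℝ → E) :
    quasiPeriodicExt B T (c • w) = c • quasiPeriodicExt B T w := by
  funext s
  simp [quasiPeriodicExt]

/-- Only countably many shifts occur, and each pulls null sets back to null sets; so the extension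
is well defined on `L²` classes. -/
theorem quasiPeriodicExt_congr_ae (hT : 0 < T) {w w' : ℝ → E}
    (h : w =ᵐ[volume.restrict (Ioo 0 T)] w') :
    ∀ᵐ s : ℝ, s < T → quasiPeriodicExt B T w s = quasiPeriodicExt B T w' s := by
  rw [restrict_Ioo_eq_restrict_Ico] at h
  have h1 := (ae_restrict_iff' measurableSet_Ico).1 h
  have h2 : ∀ᵐ s : ℝ, ∀ k : ℕ, s + k * T ∈ Ico 0 T → w (s + k * T) = w' (s + k * T) :=
    ae_all_iff.2 fun k => (quasiMeasurePreserving_add_right volume (k * T)).ae h1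
  filter_upwards [h2] with s hs hsT
  rw [quasiPeriodicExt, quasiPeriodicExt,
    hs _ ⟨add_ceil_mul_nonneg hT s, add_ceil_mul_lt hT hsT⟩]

theorem quasiPeriodicExt_translate_congr_ae (hT : 0 < T) {w w' : ℝ → E} {t : ℝ} (ht : 0 ≤ t)
    (h : w =ᵐ[volume.restrict (Ioo 0 T)] w') :
    (fun s => quasiPeriodicExt B T w (s - t)) =ᵐ[volume.restrict (Ioo 0 T)]
      fun s => quasiPeriodicExt B T w' (s - t) := by
  refine (ae_restrict_iff' measurableSet_Ioo).2 ?_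
  filter_upwards [(measurePreserving_sub_right volume t).quasiMeasurePreserving.ae
    (quasiPeriodicExt_congr_ae (B := B) hT h)] with s hs hsm
  exact hs (by linarith [hsm.2])

theorem stronglyMeasurable_quasiPeriodicExt [MeasurableSpace E] [BorelSpace E]
    [SecondCountableTopology E] {w : ℝ → E} (hw : StronglyMeasurable w) :
    StronglyMeasurable (quasiPeriodicExt B T w) := by
  have h1 : Measurable fun p : ℕ × ℝ => (B ^ p.1) (w (p.2 + p.1 * T)) :=
    measurable_from_prod_countable_right fun k =>
      (B ^ k).continuous.measurable.comp (hw.measurable.comp (by fun_prop : Measurable fun s : ℝ => s + k * T))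
  have h2 : Measurable fun s : ℝ => (⌈-s / T⌉₊, s) :=
    (Nat.measurable_ceil.comp (by fun_prop)).prodMk measurable_id
  exact (h1.comp h2).stronglyMeasurable

/-- On `(-N T, T)` at most `N` applications of `B` are used, so the value is controlled by one of
the summands. The sum avoids splitting the interval and suits Minkowski's inequality. -/
theorem enorm_quasiPeriodicExt_le (hT : 0 < T) (w : ℝ → E) (N : ℕ) (s : ℝ) :
    ‖(Ioo (-(N * T)) T).indicator (quasiPeriodicExt B T w) s‖ₑ ≤
      ‖∑ k ∈ Finset.range (N + 1), ‖B ^ k‖ * ‖(Ico 0 T).indicator w (s + k * T)‖‖ₑ := by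
  by_cases hs : s ∈ Ioo (-(N * T)) T
  · rw [indicator_of_mem hs]
    have h1 : ⌈-s / T⌉₊ ∈ Finset.range (N + 1) := by
      rw [Finset.mem_range, Nat.lt_succ_iff, Nat.ceil_le, div_le_iff₀ hT]
      linarith [hs.1]
    rw [enorm_le_iff_norm_le, Real.norm_of_nonneg (by positivity)]
    refine le_trans ?_ (Finset.single_le_sum (fun k _ => by positivity) h1)
    rw [indicator_of_mem (show s + ⌈-s / T⌉₊ * T ∈ Ico 0 T from
      ⟨add_ceil_mul_nonneg hT s, add_ceil_mul_lt hT hs.2⟩)]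
    exact ContinuousLinearMap.le_opNorm _ _
  · rw [indicator_of_notMem hs]
    simp

theorem eLpNorm_quasiPeriodicExt_le (hT : 0 < T) {w : ℝ → E}
    (hw : AEStronglyMeasurable w (volume.restrict (Ioo 0 T))) (N : ℕ) :
    eLpNorm ((Ioo (-(N * T)) T).indicator (quasiPeriodicExt B T w)) 2 volume ≤
      (∑ k ∈ Finset.range (N + 1), ‖B ^ k‖ₑ) * eLpNorm w 2 (volume.restrict (Ioo 0 T)) := by
  rw [restrict_Ioo_eq_restrict_Ico] at hw ⊢
  have hw' : AEStronglyMeasurable ((Ico 0 T).indicator w) volume :=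
    (aestronglyMeasurable_indicator_iff measurableSet_Ico).2 hw
  have hmp : ∀ k : ℕ, MeasurePreserving (fun s : ℝ => s + k * T) volume volume := fun k =>
    measurePreserving_add_right volume _
  refine (eLpNorm_mono_enorm (enorm_quasiPeriodicExt_le hT w N)).trans ?_
  have h1 := eLpNorm_sum_le (μ := volume) (p := 2) (s := Finset.range (N + 1))
    (f := fun (k : ℕ) s => ‖B ^ k‖ * ‖(Ico 0 T).indicator w (s + k * T)‖)
    (fun k _ => ((hw'.comp_measurePreserving (hmp k)).norm.const_mul _)) (by norm_num)
  rw [Finset.sum_fn] at h1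
  refine h1.trans (le_of_eq ?_)
  rw [Finset.sum_mul]
  refine Finset.sum_congr rfl fun k _ => ?_
  rw [show (fun s => ‖B ^ k‖ * ‖(Ico 0 T).indicator w (s + k * T)‖) =
    ‖B ^ k‖ • fun s => ‖((Ico 0 T).indicator w ∘ fun s => s + k * T) s‖ from rfl,
    eLpNorm_const_smul, eLpNorm_norm, eLpNorm_comp_measurePreserving hw' (hmp k), enorm_norm,
    eLpNorm_indicator_eq_eLpNorm_restrict measurableSet_Ico]

/-- Shifting `(0, T)` to the left by `t` stays inside `(-N T, T)` for `N = ⌈t / T⌉`. -/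
theorem eLpNorm_quasiPeriodicExt_translate_le (hT : 0 < T) {w : ℝ → E}
    (hw : AEStronglyMeasurable w (volume.restrict (Ioo 0 T)))
    (hm : StronglyMeasurable (quasiPeriodicExt B T w)) {t : ℝ} (ht : 0 ≤ t) :
    eLpNorm (fun s => quasiPeriodicExt B T w (s - t)) 2 (volume.restrict (Ioo 0 T)) ≤
      (∑ k ∈ Finset.range (⌈t / T⌉₊ + 1), ‖B ^ k‖ₑ) *
        eLpNorm w 2 (volume.restrict (Ioo 0 T)) := by
  refine le_trans ?_ (eLpNorm_quasiPeriodicExt_le hT hw ⌈t / T⌉₊)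
  rw [← eLpNorm_indicator_eq_eLpNorm_restrict measurableSet_Ioo]
  rw [← eLpNorm_comp_measurePreserving
    (hm.indicator measurableSet_Ioo).aestronglyMeasurable (measurePreserving_sub_right volume t)]
  refine eLpNorm_mono_enorm fun s => ?_
  by_cases hs : s ∈ Ioo 0 T
  · rw [indicator_of_mem hs, Function.comp, indicator_of_mem]
    have := (div_le_iff₀ hT).1 (Nat.le_ceil (t / T))
    exact ⟨by linarith [hs.1], by linarith [hs.2]⟩
  · rw [indicator_of_notMem hs]
    simp

end QuasiPeriodic

/-! ### The translation semigroup on `L²(0, T; E)` and its generator -/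

section Model

theorem intervalIntegral_congr_ae_restrict {F : Type*} [NormedAddCommGroup F] [NormedSpace ℝ F]
    {f g : ℝ → F} {T s : ℝ} (h : f =ᵐ[volume.restrict (Ioo 0 T)] g) (hs : s ∈ Icc 0 T) :
    ∫ r in (0 : ℝ)..s, f r = ∫ r in (0 : ℝ)..s, g r := by
  rw [restrict_Ioo_eq_restrict_Ioc, EventuallyEq, ae_restrict_iff' measurableSet_Ioc] at h
  refine intervalIntegral.integral_congr_ae ?_
  filter_upwards [h] with r hr hr'
  rw [uIoc_of_le hs.1] at hr'
  exact hr ⟨hr'.1, hr'.2.trans hs.2⟩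

/-- The space `L²(0, T; E)`. -/
abbrev IntervalL2 (E : Type*) [NormedAddCommGroup E] (T : ℝ) : Type _ :=
  Lp E 2 (volume.restrict (Ioo (0 : ℝ) T))

variable {E : Type*} [NormedAddCommGroup E]

theorem IntervalL2.intervalIntegrable {T : ℝ} (x : IntervalL2 E T) {s : ℝ} (hs : s ∈ Icc 0 T) :
    IntervalIntegrable x volume 0 s := by
  have h : IntervalIntegrable x volume 0 T := by
    rw [intervalIntegrable_iff_integrableOn_Ioo_of_le (hs.1.trans hs.2)]
    exact (Lp.memLp x).integrable (by norm_num)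
  refine h.mono_set ?_
  rw [uIcc_of_le hs.1, uIcc_of_le (hs.1.trans hs.2)]
  exact Icc_subset_Icc_right hs.2

variable [NormedSpace ℂ E]

/-- The pairs `(x, y)` with `x ∈ H¹(0, T; E)`, `y = -x'` and boundary condition `b (x(0)) (x(T))`. -/
def transportRel (T : ℝ) (b : E → E → Prop) : Set (IntervalL2 E T × IntervalL2 E T) :=
  {p | ∃ c : E, (p.1 =ᵐ[volume.restrict (Ioo 0 T)] fun s => c - ∫ r in (0 : ℝ)..s, p.2 r) ∧
    b c (c - ∫ r in (0 : ℝ)..T, p.2 r)}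

/-- The boundary condition `c = B x(T)` says precisely that the two pieces of the extension match at
`0`, so no jump spoils the primitive there. -/
theorem quasiPeriodicExt_primitive [CompleteSpace E] {T : ℝ} (hT : 0 < T) (B : E →L[ℂ] E) (y : IntervalL2 E T)
    {c : E} (hc : c = B (c - ∫ r in (0 : ℝ)..T, y r)) {s : ℝ} (hs : s ∈ Ioo (-T) T) :
    quasiPeriodicExt B T (fun s => c - ∫ r in (0 : ℝ)..s, y r) s =
      c - ∫ r in (0 : ℝ)..s, quasiPeriodicExt B T y r := by
  rcases le_or_gt 0 s with h | h
  · rw [quasiPeriodicExt_of_nonneg hT _ h]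
    congr 1
    refine intervalIntegral.integral_congr fun r hr => ?_
    rw [uIcc_of_le h] at hr
    exact (quasiPeriodicExt_of_nonneg hT _ hr.1).symm
  · have hsT : s + T ∈ Icc 0 T := ⟨by linarith [hs.1], by linarith⟩
    rw [quasiPeriodicExt_of_neg hT _ h, quasiPeriodicExt_of_nonneg hT _ hsT.1]
    have h1 : ∫ r in (0 : ℝ)..s, quasiPeriodicExt B T y r =
        -B (∫ r in (s + T)..T, y r) := by
      rw [intervalIntegral.integral_symm, ← B.intervalIntegral_comp_comm]
      · have h2 := intervalIntegral.integral_comp_add_right (a := s) (b := 0)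
          (fun r => B (y r)) T
        rw [zero_add] at h2
        rw [← h2]
        congr 1
        refine intervalIntegral.integral_congr_ae ?_
        -- The recursion for the extension holds only at strictly negative points, so the endpoint
        -- `0` is discarded.
        have h0 : ∀ᵐ r : ℝ, r ≠ 0 := Measure.ae_ne volume 0
        filter_upwards [h0] with r hr0 hr
        rw [uIoc_of_le h.le] at hr
        have hr1 : r < 0 := lt_of_le_of_ne hr.2 hr0
        rw [quasiPeriodicExt_of_neg hT _ hr1, quasiPeriodicExt_of_nonneg hT _]
        linarith [hr.1, hsT.1]
      · exact (y.intervalIntegrable hsT).symm.trans (y.intervalIntegrable (right_mem_Icc.2 hT.le))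
    rw [h1]
    conv_rhs => rw [hc]
    rw [sub_neg_eq_add, ← map_add, ← intervalIntegral.integral_add_adjacent_intervals
      (y.intervalIntegrable hsT)
      ((y.intervalIntegrable hsT).symm.trans (y.intervalIntegrable (right_mem_Icc.2 hT.le)))]
    congr 1
    abel

/-- Variation of constants: `a x + x' = f`, `x(0) = c` is solved by `exp(-as) (c + ∫₀ˢ exp(ar) f(r)
dr)`. What remains is the boundary condition, an equation for `c` alone with `d = ∫₀ᵀ exp(ar) f(r)
dr`. -/
theorem transportRel_resolvent_surjective [SecondCountableTopology E] [CompleteSpace E]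
    {T : ℝ} (hT : 0 < T) {b : E → E → Prop} {a : ℝ}
    (hb : ∀ d : E, ∃ c : E, b c (Real.exp (-(a * T)) • (c + d))) (f : IntervalL2 E T) :
    ∃ p ∈ transportRel T b, (a : ℂ) • p.1 - p.2 = f := by
  let g : ℝ → E := fun r => Real.exp (a * r) • f r
  have hexp : Continuous fun r : ℝ => Real.exp (a * r) := by fun_prop
  have hg : ∀ s ∈ Icc 0 T, IntervalIntegrable g volume 0 s := fun s hs =>
    (f.intervalIntegrable hs).continuousOn_smul hexp.continuousOn
  obtain ⟨c, hc⟩ := hb (∫ r in (0 : ℝ)..T, g r)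
  let w : ℝ → E := fun s => Real.exp (-(a * s)) • (c + ∫ r in (0 : ℝ)..s, g r)
  have hwc : ContinuousOn w (Icc 0 T) := by
    have h1 := ((hg T (right_mem_Icc.2 hT.le)).absolutelyContinuousOnInterval_primitive
      (left_mem_uIcc)).continuousOn
    rw [uIcc_of_le hT.le] at h1
    exact ContinuousOn.smul (f := fun s => Real.exp (-(a * s))) (by fun_prop) (continuousOn_const.add h1)
  have hwm : MemLp w 2 (volume.restrict (Ioo 0 T)) := by
    obtain ⟨C, hC⟩ := isCompact_Icc.exists_bound_of_continuousOn hwc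
    refine MemLp.of_bound ((hwc.mono Ioo_subset_Icc_self).aestronglyMeasurable
      measurableSet_Ioo) C ?_
    filter_upwards [ae_restrict_mem measurableSet_Ioo] with s hs
    exact hC s (Ioo_subset_Icc_self hs)
  have hym : MemLp (a • w - (f : ℝ → E)) 2 (volume.restrict (Ioo 0 T)) :=
    (hwm.const_smul a).sub (Lp.memLp f)
  have hyint : ∀ s ∈ Icc 0 T, ∫ r in (0 : ℝ)..s, hym.toLp _ r =
      ∫ r in (0 : ℝ)..s, (a • w r - f r) := by
    intro s hs
    exact intervalIntegral_congr_ae_restrict hym.coeFn_toLp hs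
  -- Integrated form of `w' = f - a w`, obtained by parts because `f` is only integrable.
  have hw : ∀ s ∈ Icc 0 T, w s = c - ∫ r in (0 : ℝ)..s, hym.toLp _ r := by
    intro s hs
    have hsub : uIcc 0 s ⊆ Icc 0 T := by
      rw [uIcc_of_le hs.1]; exact Icc_subset_Icc_right hs.2
    have hder : ∀ r : ℝ, HasDerivAt (fun r : ℝ => Real.exp (-(a * r)))
        (-(a * Real.exp (-(a * r)))) r := by
      intro r
      have := ((hasDerivAt_id r).const_mul a).neg.exp
      convert! this using 1
      simp only [Pi.neg_apply, id, mul_one]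
      ring
    have hibp := integral_smul_eq_sub_integral_deriv_smul_primitive hder (by fun_prop) (hg s hs)
    have hf : ∫ r in (0 : ℝ)..s, Real.exp (-(a * r)) • g r = ∫ r in (0 : ℝ)..s, f r := by
      refine intervalIntegral.integral_congr fun r _ => ?_
      simp only [g, smul_smul, ← Real.exp_add, neg_add_cancel, Real.exp_zero, one_smul]
    have hconst : ∫ r in (0 : ℝ)..s, -(a * Real.exp (-(a * r))) • c =
        Real.exp (-(a * s)) • c - c := by
      rw [intervalIntegral.integral_smul_const, intervalIntegral.integral_eq_sub_of_hasDerivAt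
        (fun r _ => hder r) (Continuous.intervalIntegrable (by fun_prop) _ _), sub_smul]
      simp
    have hi1 : IntervalIntegrable (fun r => -(a * Real.exp (-(a * r))) • c) volume 0 s :=
      Continuous.intervalIntegrable (by fun_prop) _ _
    have hGc : ContinuousOn (fun r => ∫ u in (0 : ℝ)..r, g u) (uIcc 0 s) :=
      ((hg s hs).absolutelyContinuousOnInterval_primitive left_mem_uIcc).continuousOn
    have hi2 : IntervalIntegrable
        (fun r => -(a * Real.exp (-(a * r))) • ∫ u in (0 : ℝ)..r, g u) volume 0 s :=
      (ContinuousOn.smul (f := fun r => -(a * Real.exp (-(a * r)))) (by fun_prop) hGc).intervalIntegrable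
    have hw' : ∫ r in (0 : ℝ)..s, a • w r =
        -(∫ r in (0 : ℝ)..s, -(a * Real.exp (-(a * r))) • c) -
          ∫ r in (0 : ℝ)..s, -(a * Real.exp (-(a * r))) • ∫ u in (0 : ℝ)..r, g u := by
      rw [← neg_add', ← intervalIntegral.integral_add hi1 hi2, ← intervalIntegral.integral_neg]
      refine intervalIntegral.integral_congr fun r _ => ?_
      simp only [w, smul_smul, smul_add, neg_smul, neg_add, neg_neg]
    have hi3 : IntervalIntegrable (fun r => a • w r) volume 0 s :=
      (hwc.mono hsub).intervalIntegrable.smul a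
    rw [hyint s hs, intervalIntegral.integral_sub hi3 (f.intervalIntegrable hs), hw', hconst, ← hf,
      hibp]
    simp only [w, smul_add]
    abel
  refine ⟨(hwm.toLp _, hym.toLp _), ⟨c, ?_, ?_⟩, ?_⟩
  · filter_upwards [hwm.coeFn_toLp, ae_restrict_mem measurableSet_Ioo] with s h1 hs
    rw [h1, hw s (Ioo_subset_Icc_self hs)]
  · simp only
    rw [← hw T (right_mem_Icc.2 hT.le)]
    exact hc
  · refine Lp.ext ?_
    filter_upwards [Lp.coeFn_sub ((a : ℂ) • hwm.toLp _) (hym.toLp _),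
      Lp.coeFn_smul (a : ℂ) (hwm.toLp _), hwm.coeFn_toLp, hym.coeFn_toLp] with s h1 h2 h3 h4
    rw [h1, Pi.sub_apply, h2, Pi.smul_apply, h3, h4, Pi.sub_apply, Pi.smul_apply,
      Complex.coe_smul, sub_sub_cancel]

variable [MeasurableSpace E] [BorelSpace E] [SecondCountableTopology E]

theorem IntervalL2.memLp_translate {T : ℝ} (hT : 0 < T) (B : E →L[ℂ] E) (x : IntervalL2 E T)
    {t : ℝ} (ht : 0 ≤ t) : MemLp (fun s => quasiPeriodicExt B T x (s - t)) 2
      (volume.restrict (Ioo 0 T)) := by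
  have hm := stronglyMeasurable_quasiPeriodicExt (B := B) (T := T) (Lp.stronglyMeasurable x)
  refine ⟨(hm.comp_measurable (measurable_id.sub_const t)).aestronglyMeasurable,
    (eLpNorm_quasiPeriodicExt_translate_le hT (Lp.aestronglyMeasurable x) hm ht).trans_lt ?_⟩
  exact ENNReal.mul_lt_top (ENNReal.sum_lt_top.2 fun _ _ => enorm_lt_top) (Lp.memLp x).2

/-- Translation with the reflux condition `x(0) = B x(T)`. -/
noncomputable def translationOp {T : ℝ} (hT : 0 < T) (B : E →L[ℂ] E) (t : ℝ≥0) :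
    IntervalL2 E T →L[ℂ] IntervalL2 E T :=
  LinearMap.mkContinuous
    { toFun := fun x => (IntervalL2.memLp_translate hT B x t.coe_nonneg).toLp _
      map_add' := fun x y => by
        rw [← MemLp.toLp_add]
        refine (MemLp.toLp_eq_toLp_iff _ _).2 ?_
        refine (quasiPeriodicExt_translate_congr_ae hT t.coe_nonneg (Lp.coeFn_add x y)).trans ?_
        rw [quasiPeriodicExt_add]
        rfl
      map_smul' := fun c x => by
        rw [RingHom.id_apply, ← MemLp.toLp_const_smul]
        refine (MemLp.toLp_eq_toLp_iff _ _).2 ?_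
        refine (quasiPeriodicExt_translate_congr_ae hT t.coe_nonneg (Lp.coeFn_smul c x)).trans ?_
        rw [quasiPeriodicExt_smul]
        rfl }
    (∑ k ∈ Finset.range (⌈t / T⌉₊ + 1), ‖B ^ k‖) fun x => by
      have hm := stronglyMeasurable_quasiPeriodicExt (B := B) (T := T) (Lp.stronglyMeasurable x)
      have h := eLpNorm_quasiPeriodicExt_translate_le hT (Lp.aestronglyMeasurable x) hm t.coe_nonneg
      rw [LinearMap.coe_mk, AddHom.coe_mk]
      rw [Lp.norm_toLp, Lp.norm_def]
      have h2 := ENNReal.toReal_mono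
        (ENNReal.mul_ne_top (ENNReal.sum_lt_top.2 fun _ _ => enorm_lt_top).ne (Lp.memLp x).2.ne) h
      rw [ENNReal.toReal_mul, ENNReal.toReal_sum (fun _ _ => enorm_ne_top)] at h2
      simpa only [toReal_enorm] using h2

theorem translationOp_coeFn {T : ℝ} (hT : 0 < T) (B : E →L[ℂ] E) (t : ℝ≥0)
    (x : IntervalL2 E T) : translationOp hT B t x =ᵐ[volume.restrict (Ioo 0 T)]
      fun s => quasiPeriodicExt B T x (s - t) :=
  (IntervalL2.memLp_translate hT B x t.coe_nonneg).coeFn_toLp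

/-- Translating by less than `T` sees only the window `(-T, T)`; the cut-off gives a function to
which the results on `L²(ℝ)` apply. -/
theorem IntervalL2.memLp_indicator_ext {T : ℝ} (hT : 0 < T) (B : E →L[ℂ] E) (x : IntervalL2 E T) :
    StronglyMeasurable ((Ioo (-T) T).indicator (quasiPeriodicExt B T x)) ∧
    MemLp ((Ioo (-T) T).indicator (quasiPeriodicExt B T x)) 2 volume := by
  have hm := (stronglyMeasurable_quasiPeriodicExt (B := B) (T := T)
    (Lp.stronglyMeasurable x)).indicator (measurableSet_Ioo (a := -T) (b := T))
  refine ⟨hm, hm.aestronglyMeasurable, ?_⟩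
  have h := eLpNorm_quasiPeriodicExt_le (B := B) hT (Lp.aestronglyMeasurable x) 1
  rw [Nat.cast_one, one_mul] at h
  exact h.trans_lt
    (ENNReal.mul_lt_top (ENNReal.sum_lt_top.2 fun _ _ => enorm_lt_top) (Lp.memLp x).2)

/-- The semigroup of the transport equation `∂ₜ x = -∂ₛ x`, `x(0) = B x(T)`. -/
noncomputable def translationSemigroup {T : ℝ} (hT : 0 < T) (B : E →L[ℂ] E) :
    C0Semigroup (IntervalL2 E T) where
  op := translationOp hT B
  op_zero := by
    ext1 x
    refine Lp.ext ((translationOp_coeFn hT B 0 x).trans ?_)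
    refine (ae_restrict_iff' measurableSet_Ioo).2 (.of_forall fun s hs => ?_)
    simp only [NNReal.coe_zero, sub_zero]
    exact quasiPeriodicExt_of_nonneg hT _ hs.1.le
  op_add s t := by
    ext1 x
    refine Lp.ext ((translationOp_coeFn hT B (s + t) x).trans ?_)
    refine ((translationOp_coeFn hT B s _).trans
      ((quasiPeriodicExt_translate_congr_ae hT s.coe_nonneg (translationOp_coeFn hT B t x)).trans ?_)).symm
    refine (ae_restrict_iff' measurableSet_Ioo).2 (.of_forall fun r hr => ?_)
    dsimp only
    have hs0 : (0 : ℝ) ≤ s := s.coe_nonneg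
    rw [quasiPeriodicExt_translate hT _ t.coe_nonneg (by linarith [hr.2]), NNReal.coe_add, sub_sub]
  strongly_continuous x := by
    obtain ⟨-, hv⟩ := x.memLp_indicator_ext hT B
    have h0 : Tendsto ((↑) : ℝ≥0 → ℝ) (𝓝[>] 0) (𝓝 0) :=
      (NNReal.continuous_coe.tendsto 0).mono_left nhdsWithin_le_nhds
    have h1 := (tendsto_eLpNorm_translate_sub hv).comp h0
    rw [Lp.tendsto_Lp_iff_tendsto_eLpNorm']
    refine tendsto_of_tendsto_of_tendsto_of_le_of_le' tendsto_const_nhds h1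
      (.of_forall fun _ => zero_le) ?_
    have hT' : (0 : ℝ≥0) < ⟨T, hT.le⟩ := hT
    filter_upwards [Ioo_mem_nhdsGT hT'] with t ht
    have ht1 : (t : ℝ) < T := ht.2
    have ht0 : (0 : ℝ) < t := ht.1
    refine le_trans (le_of_eq (eLpNorm_congr_ae ?_))
      (eLpNorm_mono_measure _ (Measure.restrict_le_self (s := Ioo 0 T)))
    filter_upwards [translationOp_coeFn hT B t x, ae_restrict_mem measurableSet_Ioo] with s h2 hs
    simp only [Pi.sub_apply, h2]
    rw [indicator_of_mem, indicator_of_mem, quasiPeriodicExt_of_nonneg hT _ hs.1.le]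
    · exact ⟨by linarith [hs.1], hs.2⟩
    · exact ⟨by linarith [hs.1], by linarith [hs.2]⟩

variable [CompleteSpace E]

/-- For `0 < t < T` the difference quotient at `s` is the average over `[s - t, s]` of the extension
of `y`, and such averages converge to `y` in `L²`. -/
theorem transportRel_subset_generator {T : ℝ} (hT : 0 < T) (B : E →L[ℂ] E)
    (p : IntervalL2 E T × IntervalL2 E T) (hp : p ∈ transportRel T fun c d => c = B d) :
    (translationSemigroup hT B).InGenerator p.1 p.2 := by
  obtain ⟨x, y⟩ := p
  obtain ⟨c, hx, hc⟩ := hp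
  obtain ⟨hvm, hv⟩ := y.memLp_indicator_ext hT B
  set v := (Ioo (-T) T).indicator (quasiPeriodicExt B T y)
  have hcoe : Tendsto ((↑) : ℝ≥0 → ℝ) (𝓝[>] 0) (𝓝[>] 0) := by
    refine tendsto_nhdsWithin_iff.2
      ⟨(NNReal.continuous_coe.tendsto 0).mono_left nhdsWithin_le_nhds, ?_⟩
    filter_upwards [self_mem_nhdsWithin] with t ht
    exact ht
  have h1 := (tendsto_eLpNorm_average_sub hvm hv).comp hcoe
  rw [C0Semigroup.InGenerator, Lp.tendsto_Lp_iff_tendsto_eLpNorm']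
  refine tendsto_of_tendsto_of_tendsto_of_le_of_le' tendsto_const_nhds h1
    (.of_forall fun _ => zero_le) ?_
  have hT' : (0 : ℝ≥0) < ⟨T, hT.le⟩ := hT
  filter_upwards [Ioo_mem_nhdsGT hT'] with t ht
  have ht1 : (t : ℝ) < T := ht.2
  have ht0 : (0 : ℝ) < t := ht.1
  refine le_trans (le_of_eq (eLpNorm_congr_ae ?_))
    (eLpNorm_mono_measure _ (Measure.restrict_le_self (s := Ioo 0 T)))
  have hop : (translationSemigroup hT B).op t x = translationOp hT B t x := rfl
  rw [hop]
  have hvi : ∀ a b : ℝ, IntervalIntegrable v volume a b := fun a b =>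
    ((hv.locallyIntegrable (by norm_num)).integrableOn_isCompact isCompact_uIcc).intervalIntegrable
  filter_upwards [translationOp_coeFn hT B t x, ae_restrict_mem measurableSet_Ioo,
    quasiPeriodicExt_translate_congr_ae (B := B) hT t.coe_nonneg hx, hx,
    Lp.coeFn_smul (((t : ℝ) : ℂ)⁻¹) (translationOp hT B t x - x),
    Lp.coeFn_sub (translationOp hT B t x) x] with s h2 hs h3 h4 h5 h6
  have hmem : s ∈ Ioo (-T) T := ⟨by linarith [hs.1], hs.2⟩
  have hmem' : s - t ∈ Ioo (-T) T := ⟨by linarith [hs.1], by linarith [hs.2]⟩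
  have hprim : ∀ r ∈ Ioo (-T) T, quasiPeriodicExt B T (fun s => c - ∫ r in (0 : ℝ)..s, y r) r =
      c - ∫ r in (0 : ℝ)..r, v r := by
    intro r hr
    rw [quasiPeriodicExt_primitive hT B y hc hr]
    congr 1
    refine intervalIntegral.integral_congr fun q hq => ?_
    have : q ∈ Ioo (-T) T := ordConnected_Ioo.uIcc_subset ⟨by linarith, hT⟩ hr hq
    exact (indicator_of_mem this _).symm
  have h7 : x s = c - ∫ r in (0 : ℝ)..s, v r := by
    rw [← hprim s hmem, quasiPeriodicExt_of_nonneg hT _ hs.1.le, h4]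
  have h8 : v s = y s := by
    rw [← quasiPeriodicExt_of_nonneg (B := B) hT y hs.1.le]
    exact indicator_of_mem hmem _
  simp only [Pi.sub_apply, Pi.smul_apply, h5, h6, h2, h3, h7, h8, hprim _ hmem']
  rw [sub_sub_sub_cancel_left, intervalIntegral.integral_interval_sub_left (hvi _ _) (hvi _ _),
    ← Complex.ofReal_inv, Complex.coe_smul]

/-- Large `a` serves two purposes: `exp a > ‖S(1)‖` excludes the eigenvalue `a`, and `‖exp(-aT) B‖ <
1` makes the boundary equation solvable by a Neumann series. -/
theorem exists_generates_transportRel {T : ℝ} (hT : 0 < T) (B : E →L[ℂ] E) :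
    ∃ S : C0Semigroup (IntervalL2 E T),
      ∀ x y, (x, y) ∈ transportRel T (fun c d => c = B d) ↔ S.InGenerator x y := by
  let S := translationSemigroup (E := E) hT B
  have h1 : ∀ᶠ a in atTop, ‖S.op 1‖ < Real.exp a :=
    Real.tendsto_exp_atTop.eventually_gt_atTop _
  have h2 : Tendsto (fun a : ℝ => ‖Real.exp (-(a * T)) • B‖) atTop (𝓝 0) := by
    have h3 : Tendsto (fun a : ℝ => Real.exp (-(a * T))) atTop (𝓝 0) :=
      Real.tendsto_exp_neg_atTop_nhds_zero.comp (tendsto_id.atTop_mul_const hT)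
    simpa using (h3.smul_const B).norm
  obtain ⟨a, ha, ha'⟩ := (h1.and (h2.eventually_lt_const one_pos)).exists
  refine ⟨S, C0Semigroup.inGenerator_iff_of_subset (transportRel_subset_generator hT B) ha ?_⟩
  refine transportRel_resolvent_surjective hT fun d => ?_
  have hu := isUnit_one_sub_of_norm_lt_one ha'
  obtain ⟨u, hu⟩ := hu
  set B' := Real.exp (-(a * T)) • B with hB'
  -- The boundary equation is `c = B' (c + d)`, hence `c = (1 - B')⁻¹ B' d`.
  refine ⟨(↑u⁻¹ : E →L[ℂ] E) (B' d), ?_⟩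
  have h3 : (1 - B') ((↑u⁻¹ : E →L[ℂ] E) (B' d)) = B' d := by
    rw [← hu, ← mul_apply_eq_comp, Units.mul_inv]
    rfl
  have h4 : ∀ e, B (Real.exp (-(a * T)) • e) = B' e := fun e => by
    rw [hB', smul_apply, ContinuousLinearMap.map_smul_of_tower]
  rw [h4, map_add]
  nth_rw 3 [← h3]
  simp

end Model

/-! ### Boundary conditions that do not generate a semigroup -/

section Truncation

/-- A Taylor bound whose constant does not depend on the base point, so it also differentiates the
`L²`-valued curve `t ↦ max(· - t, 0)² β`. -/
theorem abs_max_zero_sq_sub_le (a b : ℝ) :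
    |max a 0 ^ 2 - max b 0 ^ 2 - (a - b) * (2 * max b 0)| ≤ (a - b) ^ 2 := by
  rw [abs_le]
  rcases le_total a 0 with ha | ha <;> rcases le_total b 0 with hb | hb
  · rw [max_eq_right ha, max_eq_right hb]
    constructor <;> nlinarith [sq_nonneg (a - b)]
  · rw [max_eq_right ha, max_eq_left hb]
    constructor <;> nlinarith [mul_nonneg (neg_nonneg.2 ha) hb, sq_nonneg (a - b)]
  · rw [max_eq_left ha, max_eq_right hb]
    constructor <;> nlinarith [mul_nonneg ha (neg_nonneg.2 hb), sq_nonneg (a - b)]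
  · rw [max_eq_left ha, max_eq_left hb]
    constructor <;> nlinarith [sq_nonneg (a - b)]

theorem hasDerivAt_of_norm_sub_le_sq {F : Type*} [NormedAddCommGroup F] [NormedSpace ℝ F]
    {f : ℝ → F} {f' : F} {x C : ℝ} (h : ∀ y, ‖f y - f x - (y - x) • f'‖ ≤ C * (y - x) ^ 2) :
    HasDerivAt f f' x := by
  rw [hasDerivAt_iff_isLittleO]
  have h1 : (fun y => f y - f x - (y - x) • f') =O[𝓝 x] fun y => (y - x) ^ 2 :=
    Asymptotics.IsBigO.of_bound C (.of_forall fun y => by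
      rw [Real.norm_of_nonneg (sq_nonneg _)]; exact h y)
  refine h1.trans_isLittleO ?_
  simpa using Asymptotics.isLittleO_pow_sub_sub x (m := 2) (by norm_num)

theorem hasDerivAt_max_zero_sq (t r : ℝ) :
    HasDerivAt (fun r => max (r - t) 0 ^ 2) (2 * max (r - t) 0) r := by
  refine hasDerivAt_of_norm_sub_le_sq (C := 1) fun y => ?_
  have := abs_max_zero_sq_sub_le (y - t) (r - t)
  simpa using this

end Truncation

section Nongeneration

variable {E : Type*} [NormedAddCommGroup E] {T : ℝ}

theorem Continuous.memLp_interval {f : ℝ → E} (hf : Continuous f) (T : ℝ) :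
    MemLp f 2 (volume.restrict (Ioo 0 T)) := by
  obtain ⟨C, hC⟩ := (isCompact_Icc (a := 0) (b := T)).exists_bound_of_continuousOn hf.continuousOn
  refine MemLp.of_bound hf.aestronglyMeasurable C ?_
  filter_upwards [ae_restrict_mem measurableSet_Ioo] with s hs
  exact hC s (Ioo_subset_Icc_self hs)

/-- The class in `L²(0, T; E)` of a continuous function. -/
noncomputable def IntervalL2.ofContinuous (T : ℝ) (f : ℝ → E) (hf : Continuous f) :
    IntervalL2 E T :=
  (hf.memLp_interval T).toLp f

theorem IntervalL2.ofContinuous_coeFn {f : ℝ → E} (hf : Continuous f) :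
    IntervalL2.ofContinuous T f hf =ᵐ[volume.restrict (Ioo 0 T)] f :=
  (hf.memLp_interval T).coeFn_toLp

theorem IntervalL2.eq_zero_of_ofContinuous_eq_zero {f : ℝ → E} {hf : Continuous f}
    (h : IntervalL2.ofContinuous T f hf = 0) {s : ℝ} (hs : s ∈ Ioo 0 T) : f s = 0 := by
  have h1 := (IntervalL2.ofContinuous_coeFn (T := T) hf).symm
  rw [h] at h1
  exact Measure.eqOn_open_of_ae_eq (h1.trans (Lp.coeFn_zero _ _ _)) isOpen_Ioo hf.continuousOn
    continuousOn_const hs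

/-- If the transport operator has eigenvalues with arbitrarily large real part, it is not a
generator. -/
theorem not_generates_of_eigenvectors [NormedSpace ℂ E] [CompleteSpace E] (hT : 0 < T)
    {b : E → E → Prop} (hb : ∀ a : ℝ, ∃ c ≠ 0, b c (Real.exp (-(a * T)) • c)) :
    ¬∃ S : C0Semigroup (IntervalL2 E T), ∀ x y, (x, y) ∈ transportRel T b ↔ S.InGenerator x y := by
  rintro ⟨S, hS⟩
  obtain ⟨a, ha⟩ := (Real.tendsto_exp_atTop.eventually_gt_atTop ‖S.op 1‖).exists
  obtain ⟨c, hc, hbc⟩ := hb a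
  -- This function satisfies `-x' = a x`, and its boundary values are `c` and `exp(-aT) c`.
  have hf : Continuous fun s : ℝ => Real.exp (-(a * s)) • c := by fun_prop
  set x := IntervalL2.ofContinuous T _ hf
  have hder : ∀ r : ℝ, HasDerivAt (fun r : ℝ => -(Real.exp (-(a * r)) • c))
      (a • Real.exp (-(a * r)) • c) r := by
    intro r
    have := ((((hasDerivAt_id r).const_mul a).neg.exp).smul_const c).neg
    convert! this using 1
    simp only [Pi.neg_apply, id, mul_one, smul_smul, ← neg_smul]
    congr 1
    ring
  have hint : ∀ s ∈ Icc 0 T, ∫ r in (0 : ℝ)..s, ((a : ℂ) • x) r =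
      c - Real.exp (-(a * s)) • c := by
    intro s hs
    have h1 : ((a : ℂ) • x : IntervalL2 E T) =ᵐ[volume.restrict (Ioo 0 T)]
        fun r => a • Real.exp (-(a * r)) • c := by
      filter_upwards [Lp.coeFn_smul (a : ℂ) x, IntervalL2.ofContinuous_coeFn hf] with r h2 h3
      rw [h2, Pi.smul_apply, h3, Complex.coe_smul]
    rw [intervalIntegral_congr_ae_restrict h1 hs, intervalIntegral.integral_eq_sub_of_hasDerivAt
      (fun r _ => hder r) (Continuous.intervalIntegrable (by fun_prop) _ _)]
    simp only [mul_zero, neg_zero, Real.exp_zero, one_smul]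
    abel
  have hmem : (x, (a : ℂ) • x) ∈ transportRel T b := by
    refine ⟨c, ?_, ?_⟩
    · filter_upwards [IntervalL2.ofContinuous_coeFn hf, ae_restrict_mem measurableSet_Ioo]
        with s h1 hs
      rw [h1, hint s (Ioo_subset_Icc_self hs)]
      abel
    · simp only
      rw [hint T (right_mem_Icc.2 hT.le), sub_sub_cancel]
      exact hbc
  have h0 := ((hS _ _).1 hmem).eq_zero_of_norm_lt ha
  have h1 := IntervalL2.eq_zero_of_ofContinuous_eq_zero h0 (s := T / 2)
    ⟨by linarith, by linarith⟩
  exact hc ((smul_eq_zero.1 h1).resolve_left (Real.exp_pos _).ne')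

variable [InnerProductSpace ℂ E]

theorem continuous_max_sq_smul (β : E) (t : ℝ) :
    Continuous fun s : ℝ => max (s - t) 0 ^ 2 • β := by
  fun_prop

theorem continuous_max_smul (β : E) (t : ℝ) :
    Continuous fun s : ℝ => -(2 * max (s - t) 0) • β := by
  fun_prop

theorem hasDerivAt_ofContinuous_max_sq_smul (β : E) (t : ℝ) :
    HasDerivAt (fun t => IntervalL2.ofContinuous T _ (continuous_max_sq_smul β t))
      (IntervalL2.ofContinuous T _ (continuous_max_smul β t)) t := by
  -- The power of the total measure converts the uniform bound `(r - t)² ‖β‖` into an `L²` bound.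
  refine hasDerivAt_of_norm_sub_le_sq
    (C := (measureUnivNNReal (volume.restrict (Ioo 0 T)) : ℝ) ^ (2 : ℝ≥0∞).toReal⁻¹ * ‖β‖) fun r => ?_
  refine (Lp.norm_le_of_ae_bound (C := (r - t) ^ 2 * ‖β‖) (by positivity) ?_).trans (le_of_eq ?_)
  · set P := IntervalL2.ofContinuous T _ (continuous_max_sq_smul β r)
    set P₀ := IntervalL2.ofContinuous T _ (continuous_max_sq_smul β t)
    set P' := IntervalL2.ofContinuous T _ (continuous_max_smul β t)
    filter_upwards [Lp.coeFn_sub (P - P₀) ((r - t) • P'), Lp.coeFn_sub P P₀,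
      Lp.coeFn_smul (r - t) P', IntervalL2.ofContinuous_coeFn (continuous_max_sq_smul β r),
      IntervalL2.ofContinuous_coeFn (continuous_max_sq_smul β t),
      IntervalL2.ofContinuous_coeFn (continuous_max_smul β t)] with s h1 h2 h3 h4 h5 h6
    rw [h1, Pi.sub_apply, h2, Pi.sub_apply, h3, Pi.smul_apply, h4, h5, h6, smul_smul, ← sub_smul,
      ← sub_smul, norm_smul]
    refine mul_le_mul_of_nonneg_right ?_ (norm_nonneg _)
    have := abs_max_zero_sq_sub_le (s - r) (s - t)
    rw [Real.norm_eq_abs]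
    rw [show s - r - (s - t) = -(r - t) by ring, neg_sq] at this
    convert! this using 2
    ring
  · ring

theorem IntervalL2.inner_ofContinuous_smul (hT : 0 ≤ T) {ψ : ℝ → ℝ} (β : E)
    (hψ : Continuous fun s => ψ s • β) (x : IntervalL2 E T) :
    inner ℂ (IntervalL2.ofContinuous T _ hψ) x =
      ∫ s in (0 : ℝ)..T, ψ s • (inner ℂ β (x s) : ℂ) := by
  rw [L2.inner_def, intervalIntegral.integral_of_le hT, ← restrict_Ioo_eq_restrict_Ioc]
  refine integral_congr_ae ?_
  filter_upwards [IntervalL2.ofContinuous_coeFn hψ] with s h1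
  rw [h1, ← Complex.coe_smul]
  exact inner_smul_real_left _ _ _

variable [CompleteSpace E]

/-- Integration by parts with `y = -x'`: the boundary term at `T` dies by the constraint on the
outflow, the one at `0` because `max(0 - t, 0) = 0`. -/
theorem inner_add_inner_eq_zero_of_transportRel (hT : 0 < T) {b : E → E → Prop} {β : E}
    (hb : ∀ c d, b c d → inner ℂ β d = (0 : ℂ)) {x y : IntervalL2 E T}
    (hxy : (x, y) ∈ transportRel T b) {t : ℝ} (ht : 0 ≤ t) :
    inner ℂ (IntervalL2.ofContinuous T _ (continuous_max_sq_smul β t)) y +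
      inner ℂ (IntervalL2.ofContinuous T _ (continuous_max_smul β t)) x = (0 : ℂ) := by
  obtain ⟨c, hx, hbc⟩ := hxy
  let ℓ : E →L[ℂ] ℂ := innerSL ℂ β
  have hyT := y.intervalIntegrable (right_mem_Icc.2 hT.le)
  have hg : IntervalIntegrable (fun r => ℓ (y r)) volume 0 T :=
    ⟨ℓ.integrable_comp hyT.1, ℓ.integrable_comp hyT.2⟩
  have hℓ : ∀ s ∈ Icc 0 T, ℓ (∫ r in (0 : ℝ)..s, y r) = ∫ r in (0 : ℝ)..s, ℓ (y r) := fun s hs =>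
    (ℓ.intervalIntegral_comp_comm (y.intervalIntegrable hs)).symm
  have hbd : ℓ c - ∫ r in (0 : ℝ)..T, ℓ (y r) = 0 := by
    rw [← hℓ T (right_mem_Icc.2 hT.le), ← map_sub]
    exact hb _ _ hbc
  have hibp := integral_smul_eq_sub_integral_deriv_smul_primitive (hasDerivAt_max_zero_sq t)
    (by fun_prop) hg
  have h0 : max (0 - t) 0 = 0 := max_eq_right (by linarith)
  have hconst : ∫ r in (0 : ℝ)..T, (2 * max (r - t) 0) • ℓ c = max (T - t) 0 ^ 2 • ℓ c := by
    rw [intervalIntegral.integral_smul_const, intervalIntegral.integral_eq_sub_of_hasDerivAt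
      (fun r _ => hasDerivAt_max_zero_sq t r)
      (Continuous.intervalIntegrable (by fun_prop) _ _), h0]
    simp
  have hGc : ContinuousOn (fun r => ∫ u in (0 : ℝ)..r, ℓ (y u)) (uIcc 0 T) :=
    (hg.absolutelyContinuousOnInterval_primitive left_mem_uIcc).continuousOn
  have hi1 : IntervalIntegrable (fun r => (2 * max (r - t) 0) • ℓ c) volume 0 T :=
    Continuous.intervalIntegrable (by fun_prop) _ _
  have hi2 : IntervalIntegrable (fun r => (2 * max (r - t) 0) • ∫ u in (0 : ℝ)..r, ℓ (y u))
      volume 0 T :=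
    (ContinuousOn.smul (f := fun r : ℝ => 2 * max (r - t) 0) (by fun_prop) hGc).intervalIntegrable
  have hx' : ∫ s in (0 : ℝ)..T, -(2 * max (s - t) 0) • (inner ℂ β (x s) : ℂ) =
      ∫ s in (0 : ℝ)..T,
        -((2 * max (s - t) 0) • ℓ c - (2 * max (s - t) 0) • ∫ u in (0 : ℝ)..s, ℓ (y u)) := by
    refine intervalIntegral_congr_ae_restrict ?_ (right_mem_Icc.2 hT.le)
    filter_upwards [hx, ae_restrict_mem measurableSet_Ioo] with s h1 hs
    rw [h1, ← smul_sub, ← hℓ s (Ioo_subset_Icc_self hs), ← map_sub, neg_smul]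
    rfl
  rw [IntervalL2.inner_ofContinuous_smul hT.le, IntervalL2.inner_ofContinuous_smul hT.le, hx',
    intervalIntegral.integral_neg, intervalIntegral.integral_sub hi1 hi2, hconst]
  have hy' : ∫ s in (0 : ℝ)..T, max (s - t) 0 ^ 2 • (inner ℂ β (y s) : ℂ) =
      ∫ s in (0 : ℝ)..T, max (s - t) 0 ^ 2 • ℓ (y s) := rfl
  rw [hy', hibp, sub_eq_zero.1 hbd]
  abel

/-- If the boundary condition imposes a nontrivial constraint on the outflow value `x(T)`, the
transport operator is not a generator. -/
theorem not_generates_of_outflow_constraint (hT : 0 < T) {b : E → E → Prop} {β : E} (hβ : β ≠ 0)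
    (hb : ∀ c d, b c d → inner ℂ β d = (0 : ℂ)) (hb0 : b 0 0) :
    ¬∃ S : C0Semigroup (IntervalL2 E T), ∀ x y, (x, y) ∈ transportRel T b ↔ S.InGenerator x y := by
  rintro ⟨S, hS⟩
  -- A profile vanishing at both ends lies in the domain as soon as `b 0 0` holds, and its pairing
  -- with `s² β` is positive; `(2 s - T) β` is minus its derivative.
  have hx : Continuous fun s : ℝ => (s * (T - s)) • β := by fun_prop
  have hy : Continuous fun s : ℝ => (2 * s - T) • β := by fun_prop
  set x := IntervalL2.ofContinuous T _ hx
  set y := IntervalL2.ofContinuous T _ hy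
  have hint : ∀ s ∈ Icc 0 T, ∫ r in (0 : ℝ)..s, y r = -((s * (T - s)) • β) := by
    intro s hs
    have hder : ∀ r : ℝ, HasDerivAt (fun r : ℝ => r ^ 2 - T * r) (2 * r - T) r := fun r => by
      have := (hasDerivAt_pow 2 r).sub ((hasDerivAt_id r).const_mul T)
      convert! this using 1
      simp
    rw [intervalIntegral_congr_ae_restrict (IntervalL2.ofContinuous_coeFn hy) hs,
      intervalIntegral.integral_smul_const, intervalIntegral.integral_eq_sub_of_hasDerivAt
        (fun r _ => hder r) (Continuous.intervalIntegrable (by fun_prop) _ _), ← neg_smul]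
    congr 1
    ring
  have hmem : (x, y) ∈ transportRel T b := by
    refine ⟨0, ?_, ?_⟩
    · filter_upwards [IntervalL2.ofContinuous_coeFn hx, ae_restrict_mem measurableSet_Ioo]
        with s h1 hs
      rw [h1, hint s (Ioo_subset_Icc_self hs), zero_sub, neg_neg]
    · simp only
      rw [hint T (right_mem_Icc.2 hT.le)]
      simpa using hb0
  have hgen := (hS _ _).1 hmem
  let P : ℝ → IntervalL2 E T := fun t => IntervalL2.ofContinuous T _ (continuous_max_sq_smul β t)
  have hP : ∀ t, HasDerivAt P (IntervalL2.ofContinuous T _ (continuous_max_smul β t)) t :=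
    hasDerivAt_ofContinuous_max_sq_smul β
  have hPc : Continuous P := continuous_iff_continuousAt.2 fun t => (hP t).continuousAt
  -- The orbit stays in the domain, so the constraint holds at every time and the transported
  -- pairing has zero right derivative.
  have hder : ∀ t ∈ Ico (0 : ℝ) T, HasDerivWithinAt
      (fun t => (inner ℂ (P t) (S.op t.toNNReal x) : ℂ)) 0 (Ici t) t := by
    intro t ht
    have h1 := (hP t).hasDerivWithinAt.inner ℂ (hgen.hasDerivWithinAt ht.1) (s := Ici t)
    rwa [inner_add_inner_eq_zero_of_transportRel hT hb ((hS _ _).2 (hgen.op _)) ht.1] at h1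
  have hcont : ContinuousOn (fun t => (inner ℂ (P t) (S.op t.toNNReal x) : ℂ)) (Icc 0 T) := by
    have := S.continuous_orbit_real x
    exact (hPc.inner this).continuousOn
  have hend := constant_of_has_deriv_right_zero hcont hder T (right_mem_Icc.2 hT.le)
  have hPT : P T = 0 := by
    refine Lp.ext ?_
    filter_upwards [IntervalL2.ofContinuous_coeFn (continuous_max_sq_smul β T),
      ae_restrict_mem measurableSet_Ioo, Lp.coeFn_zero E 2 (volume.restrict (Ioo 0 T))]
      with s h1 hs h2
    rw [h1, h2, max_eq_right (by linarith [hs.2])]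
    simp
  rw [hPT, inner_zero_left, Real.toNNReal_zero, S.op_zero, ContinuousLinearMap.id_apply,
    IntervalL2.inner_ofContinuous_smul hT.le] at hend
  -- The constant is `T⁵/4 - T⁵/5`, from `∫₀ᵀ s² · s (T - s) ds`.
  have hval : ∫ s in (0 : ℝ)..T, max (s - 0) 0 ^ 2 • (inner ℂ β (x s) : ℂ) =
      (T ^ 5 / 20 : ℝ) • (inner ℂ β β : ℂ) := by
    have h1 : ∫ s in (0 : ℝ)..T, max (s - 0) 0 ^ 2 • (inner ℂ β (x s) : ℂ) =
        ∫ s in (0 : ℝ)..T, (T * s ^ 3 - s ^ 4) • (inner ℂ β β : ℂ) := by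
      refine intervalIntegral_congr_ae_restrict ?_ (right_mem_Icc.2 hT.le)
      filter_upwards [IntervalL2.ofContinuous_coeFn hx, ae_restrict_mem measurableSet_Ioo]
        with s h1 hs
      have h2 : (inner ℂ β ((s * (T - s)) • β) : ℂ) = (s * (T - s)) • inner ℂ β β := by
        rw [← Complex.coe_smul]
        exact inner_smul_real_right _ _ _
      rw [h1, h2, smul_smul, sub_zero, max_eq_left hs.1.le]
      congr 1
      ring
    rw [h1, intervalIntegral.integral_smul_const, intervalIntegral.integral_sub
      (Continuous.intervalIntegrable (by fun_prop) _ _)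
      (Continuous.intervalIntegrable (by fun_prop) _ _), intervalIntegral.integral_const_mul,
      integral_pow, integral_pow]
    congr 1
    norm_num
    ring
  rw [hval] at hend
  rcases smul_eq_zero.1 hend.symm with h | h
  · exact absurd h (by positivity)
  · exact hβ (inner_self_eq_zero.1 h)

end Nongeneration

/-! ### The travel time coordinate -/

/-- A measurable version `speed` of `lam`, extended to the real line, together with the travel
time `ζ ↦ ∫₀^ζ speed⁻¹`. -/
structure TravelTime (lam : ℝ → ℝ) where
  /-- a measurable version of the speed -/
  speed : ℝ → ℝ
  /-- the travel time from `0` -/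
  time : ℝ ≃o ℝ
  measurable_speed : Measurable speed
  speed_pos : ∀ ζ, 0 < speed ζ
  speed_ae_eq : speed =ᵐ[unitMeasure] lam
  time_zero : time 0 = 0
  measurePreserving : MeasurePreserving time
    (volume.withDensity fun ζ => ((speed ζ).toNNReal⁻¹ : ℝ≥0)) volume

/-- Clamping a measurable version between the essential bounds makes them hold at every real point,
so the travel time can be defined on the whole line. -/
theorem exists_measurable_speed {lam : ℝ → ℝ} (hlam : IsSpeed lam) :
    ∃ (m : ℝ → ℝ) (ε C : ℝ), Measurable m ∧ 0 < ε ∧ (∀ ζ, ε ≤ m ζ) ∧ (∀ ζ, m ζ ≤ C) ∧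
      m =ᵐ[unitMeasure] lam := by
  obtain ⟨ε, hε, hlow⟩ := hlam.bounded_below
  set C := (eLpNorm lam ∞ unitMeasure).toReal
  have hup : ∀ᵐ ζ ∂unitMeasure, lam ζ ≤ C := by
    filter_upwards [ae_le_eLpNormEssSup (f := lam) (μ := unitMeasure)] with s hs
    rw [← eLpNorm_exponent_top] at hs
    have := ENNReal.toReal_mono hlam.memLp.2.ne hs
    rw [toReal_enorm] at this
    exact (le_abs_self _).trans this
  have hm := hlam.memLp.1
  refine ⟨fun ζ => max ε (min C (hm.mk lam ζ)), ε, max ε C,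
    measurable_const.max (measurable_const.min hm.stronglyMeasurable_mk.measurable), hε,
    fun ζ => le_max_left _ _, fun ζ => max_le_max le_rfl (min_le_left _ _), ?_⟩
  filter_upwards [hm.ae_eq_mk, hlow, hup] with ζ h1 h2 h3
  rw [← h1, min_eq_right h3, max_eq_right h2]

/-- The slowness is at least `C⁻¹`, so the travel time grows at least linearly: it is strictly
increasing and onto. The two measures agree on half-open intervals by its definition as an integral.
-/
theorem nonempty_travelTime {lam : ℝ → ℝ} (hlam : IsSpeed lam) : Nonempty (TravelTime lam) := by
  obtain ⟨m, ε, C, hm, hε, hlow, hup, hae⟩ := exists_measurable_speed hlam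
  have hpos : ∀ ζ, 0 < m ζ := fun ζ => hε.trans_le (hlow ζ)
  have hC : 0 < C := (hpos 0).trans_le (hup 0)
  have hbd : ∀ ζ, ‖(m ζ)⁻¹‖ ≤ ε⁻¹ := fun ζ => by
    rw [Real.norm_of_nonneg (inv_nonneg.2 (hpos ζ).le)]
    exact inv_anti₀ hε (hlow ζ)
  have hint : ∀ a b, IntervalIntegrable (fun ζ => (m ζ)⁻¹) volume a b := fun a b =>
    (intervalIntegrable_const (c := ε⁻¹)).mono_fun hm.inv.aestronglyMeasurable
      (.of_forall fun ζ => (hbd ζ).trans (le_abs_self _))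
  let τ : ℝ → ℝ := fun ζ => ∫ r in (0 : ℝ)..ζ, (m r)⁻¹
  have hsub : ∀ a b, τ b - τ a = ∫ r in a..b, (m r)⁻¹ := fun a b =>
    intervalIntegral.integral_interval_sub_left (hint 0 b) (hint 0 a)
  have hgrow : ∀ a b, a ≤ b → (b - a) * C⁻¹ ≤ τ b - τ a := by
    intro a b hab
    rw [hsub]
    have := intervalIntegral.integral_mono_on hab (intervalIntegrable_const (c := C⁻¹)) (hint a b)
      fun ζ _ => inv_anti₀ (hpos ζ) (hup ζ)
    simpa using this
  have hmono : StrictMono τ := fun a b hab => by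
    have h1 := hgrow a b hab.le
    have h2 : 0 < (b - a) * C⁻¹ := mul_pos (sub_pos.2 hab) (inv_pos.2 hC)
    linarith
  have hτ0 : τ 0 = 0 := intervalIntegral.integral_same
  have hcont : Continuous τ := intervalIntegral.continuous_primitive hint 0
  have hlin : Tendsto (fun ζ : ℝ => ζ * C⁻¹) atTop atTop :=
    tendsto_id.atTop_mul_const (inv_pos.2 hC)
  have hlin' : Tendsto (fun ζ : ℝ => ζ * C⁻¹) atBot atBot :=
    tendsto_id.atBot_mul_const (inv_pos.2 hC)
  have htop : Tendsto τ atTop atTop := by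
    refine tendsto_atTop_mono' _ ?_ hlin
    filter_upwards [eventually_ge_atTop 0] with ζ hζ
    have := hgrow 0 ζ hζ
    simpa [hτ0] using this
  have hbot : Tendsto τ atBot atBot := by
    refine tendsto_atBot_mono' _ ?_ hlin'
    filter_upwards [eventually_le_atBot 0] with ζ hζ
    have := hgrow ζ 0 hζ
    rw [hτ0] at this
    linarith
  let e : ℝ ≃o ℝ := hmono.orderIsoOfSurjective τ (hcont.surjective htop hbot)
  have he : ∀ ζ, e ζ = τ ζ := fun ζ => rfl
  refine ⟨⟨m, e, hm, hpos, hae, hτ0, ⟨hcont.measurable, ?_⟩⟩⟩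
  symm
  refine Measure.ext_of_Ioc _ _ fun a b hab => ?_
  obtain ⟨a, rfl⟩ := e.surjective a
  obtain ⟨b, rfl⟩ := e.surjective b
  have hab' : a ≤ b := (e.lt_iff_lt.1 hab).le
  rw [Real.volume_Ioc, Measure.map_apply e.continuous.measurable measurableSet_Ioc,
    e.preimage_Ioc, e.symm_apply_apply, e.symm_apply_apply, withDensity_apply _ measurableSet_Ioc,
    he, he, hsub, intervalIntegral.integral_of_le hab',
    ofReal_integral_eq_lintegral_ofReal
      ((intervalIntegrable_iff_integrableOn_Ioc_of_le hab').1 (hint a b))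
      (.of_forall fun ζ => inv_nonneg.2 (hpos ζ).le)]
  refine lintegral_congr fun ζ => ?_
  rw [ENNReal.ofReal, Real.toNNReal_inv]

namespace TravelTime

variable {lam : ℝ → ℝ} (τ : TravelTime lam)

/-- The total travel time. -/
noncomputable def total : ℝ := τ.time 1

theorem total_pos : 0 < τ.total := by
  rw [← τ.time_zero]
  exact τ.time.strictMono one_pos

theorem symm_zero : τ.time.symm 0 = 0 := by
  rw [OrderIso.symm_apply_eq, τ.time_zero]

theorem symm_total : τ.time.symm τ.total = 1 := τ.time.symm_apply_apply 1

theorem measurableEmbedding_symm : MeasurableEmbedding τ.time.symm :=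
  τ.time.symm.toHomeomorph.measurableEmbedding

/-- The measure `lam(ζ)⁻¹ dζ` on the real line. -/
noncomputable def slowness : Measure ℝ :=
  volume.withDensity fun ζ => ((τ.speed ζ).toNNReal⁻¹ : ℝ≥0)

theorem measurable_slowness : Measurable fun ζ => (τ.speed ζ).toNNReal⁻¹ :=
  τ.measurable_speed.real_toNNReal.inv

theorem measurePreserving_symm : MeasurePreserving τ.time.symm volume τ.slowness :=
  MeasurePreserving.symm τ.time.toHomeomorph.toMeasurableEquiv τ.measurePreserving

theorem measurePreserving_symm_restrict : MeasurePreserving τ.time.symm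
    (volume.restrict (Ioo 0 τ.total)) (τ.slowness.restrict (Ioo 0 1)) := by
  have h := τ.measurePreserving_symm.restrict_preimage_emb τ.measurableEmbedding_symm (Ioo 0 1)
  rwa [τ.time.symm.preimage_Ioo, OrderIso.symm_symm, τ.time_zero] at h

theorem slowness_restrict : τ.slowness.restrict (Ioo 0 1) =
    unitMeasure.withDensity fun ζ => ((τ.speed ζ).toNNReal⁻¹ : ℝ≥0) :=
  restrict_withDensity measurableSet_Ioo _

theorem unitMeasure_absolutelyContinuous_slowness :
    unitMeasure ≪ τ.slowness.restrict (Ioo 0 1) := by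
  rw [slowness_restrict]
  refine withDensity_absolutelyContinuous' τ.measurable_slowness.coe_nnreal_ennreal.aemeasurable
    (.of_forall fun ζ => ?_)
  simpa using τ.speed_pos ζ

theorem ae_comp_symm {p : ℝ → Prop} (h : ∀ᵐ ζ ∂unitMeasure, p ζ) :
    ∀ᵐ s ∂volume.restrict (Ioo 0 τ.total), p (τ.time.symm s) := by
  refine τ.measurePreserving_symm_restrict.quasiMeasurePreserving.ae ?_
  rw [slowness_restrict]
  exact (withDensity_absolutelyContinuous _ _).ae_le h

/-- Positivity of the density `speed⁻¹` lets null sets pass back from travel time to space. -/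
theorem ae_of_ae_comp_symm {p : ℝ → Prop}
    (h : ∀ᵐ s ∂volume.restrict (Ioo 0 τ.total), p (τ.time.symm s)) : ∀ᵐ ζ ∂unitMeasure, p ζ := by
  refine τ.unitMeasure_absolutelyContinuous_slowness.ae_le ?_
  rw [← τ.measurePreserving_symm_restrict.map_eq]
  exact (τ.measurableEmbedding_symm.ae_map_iff).2 h

theorem weightedMeasure_eq :
    weightedMeasure lam = unitMeasure.withDensity fun ζ => ((τ.speed ζ).toNNReal : ℝ≥0∞) := by
  refine withDensity_congr_ae ?_
  filter_upwards [τ.speed_ae_eq] with ζ h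
  rw [h]
  rfl

variable {E : Type*} [NormedAddCommGroup E] [NormedSpace ℂ E]

/-- The flux `lam g` as a function of the travel time. -/
noncomputable def flux (g : ℝ → E) (s : ℝ) : E :=
  ((τ.speed (τ.time.symm s) : ℝ) : ℂ) • g (τ.time.symm s)

/-- The Jacobian `speed⁻¹` turns `|speed g|²` into `speed |g|²`, exactly the weight of the state
space. -/
theorem eLpNorm_flux (g : ℝ → E) :
    eLpNorm (τ.flux g) 2 (volume.restrict (Ioo 0 τ.total)) =
      eLpNorm g 2 (weightedMeasure lam) := by
  refine (ENNReal.pow_right_strictMono two_ne_zero).injective ?_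
  rw [eLpNorm_two_sq, eLpNorm_two_sq, τ.weightedMeasure_eq,
    lintegral_withDensity_eq_lintegral_mul_non_measurable _
      τ.measurable_speed.real_toNNReal.coe_nnreal_ennreal (.of_forall fun _ => ENNReal.coe_lt_top)]
  have h := τ.measurePreserving_symm_restrict.lintegral_comp_emb τ.measurableEmbedding_symm
    fun ζ => ‖((τ.speed ζ : ℝ) : ℂ) • g ζ‖ₑ ^ 2
  refine h.trans ?_
  rw [slowness_restrict, lintegral_withDensity_eq_lintegral_mul_non_measurable _
      τ.measurable_slowness.coe_nnreal_ennreal (.of_forall fun _ => ENNReal.coe_lt_top)]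
  refine lintegral_congr fun ζ => ?_
  have hp : (τ.speed ζ).toNNReal ≠ 0 := by simpa using τ.speed_pos ζ
  have he : ‖((τ.speed ζ : ℝ) : ℂ)‖ₑ = (τ.speed ζ).toNNReal := by
    rw [enorm_eq_nnnorm, Complex.nnnorm_real, Real.nnnorm_of_nonneg (τ.speed_pos ζ).le]
    rw [Real.toNNReal_of_nonneg]
  simp only [Pi.mul_apply]
  rw [enorm_smul, he, mul_pow, ← mul_assoc, ENNReal.coe_inv hp, pow_two, ← mul_assoc,
    ENNReal.inv_mul_cancel (by simpa using hp) ENNReal.coe_ne_top, one_mul]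

theorem memLp_flux (g : Lp E 2 (weightedMeasure lam)) :
    MemLp (τ.flux g) 2 (volume.restrict (Ioo 0 τ.total)) := by
  refine ⟨?_, (τ.eLpNorm_flux g).trans_lt (Lp.memLp g).2⟩
  have h1 : AEStronglyMeasurable (fun ζ => ((τ.speed ζ : ℝ) : ℂ) • g ζ)
      (τ.slowness.restrict (Ioo 0 1)) :=
    AEStronglyMeasurable.smul
      (Complex.measurable_ofReal.comp τ.measurable_speed).aestronglyMeasurable
      (Lp.stronglyMeasurable g).aestronglyMeasurable
  exact h1.comp_measurePreserving τ.measurePreserving_symm_restrict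

/-- The isometry from the state space to `L²` in the travel time coordinate, `g ↦ lam g`. -/
noncomputable def fluxIsometry (hlam : IsSpeed lam) :
    Lp E 2 (weightedMeasure lam) →ₗᵢ[ℂ] IntervalL2 E τ.total where
  toFun g := (τ.memLp_flux g).toLp _
  map_add' g g' := by
    rw [← MemLp.toLp_add]
    refine (MemLp.toLp_eq_toLp_iff _ _).2 ?_
    filter_upwards [τ.ae_comp_symm ((unitMeasure_absolutelyContinuous hlam).ae_le
      (Lp.coeFn_add g g'))] with s hs
    simp only [flux, Pi.add_apply, hs, smul_add]
  map_smul' c g := by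
    rw [RingHom.id_apply, ← MemLp.toLp_const_smul]
    refine (MemLp.toLp_eq_toLp_iff _ _).2 ?_
    filter_upwards [τ.ae_comp_symm ((unitMeasure_absolutelyContinuous hlam).ae_le
      (Lp.coeFn_smul c g))] with s hs
    simp only [flux, Pi.smul_apply, hs]
    exact smul_comm _ _ _
  norm_map' g := by
    rw [LinearMap.coe_mk, AddHom.coe_mk, Lp.norm_toLp, Lp.norm_def, τ.eLpNorm_flux]

theorem fluxIsometry_coeFn (hlam : IsSpeed lam) (g : Lp E 2 (weightedMeasure lam)) :
    τ.fluxIsometry hlam g =ᵐ[volume.restrict (Ioo 0 τ.total)] τ.flux g :=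
  (τ.memLp_flux g).coeFn_toLp

theorem fluxIsometry_surjective (hlam : IsSpeed lam) :
    Function.Surjective (τ.fluxIsometry (E := E) hlam) := by
  intro x
  -- The inverse map: divide by the speed and return to the space variable.
  let g : ℝ → E := fun ζ => ((τ.speed ζ : ℝ) : ℂ)⁻¹ • x (τ.time ζ)
  have hflux : τ.flux g = x := by
    funext s
    have : ((τ.speed (τ.time.symm s) : ℝ) : ℂ) ≠ 0 :=
      Complex.ofReal_ne_zero.2 (τ.speed_pos _).ne'
    simp only [flux, g, smul_smul, mul_inv_cancel₀ this, one_smul, OrderIso.apply_symm_apply]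
  have hg : MemLp g 2 (weightedMeasure lam) := by
    refine ⟨?_, ?_⟩
    · refine StronglyMeasurable.aestronglyMeasurable ?_
      exact (Complex.measurable_ofReal.comp τ.measurable_speed).inv.stronglyMeasurable.smul
        ((Lp.stronglyMeasurable x).comp_measurable τ.time.continuous.measurable)
    · rw [← τ.eLpNorm_flux, hflux]
      exact (Lp.memLp x).2
  refine ⟨hg.toLp g, Lp.ext ((τ.fluxIsometry_coeFn hlam _).trans ?_)⟩
  rw [← hflux]
  filter_upwards [τ.ae_comp_symm ((unitMeasure_absolutelyContinuous hlam).ae_le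
      hg.coeFn_toLp)] with s hs
  simp only [flux, hs]

/-- The isometric isomorphism `g ↦ lam g` in the travel time coordinate. -/
noncomputable def fluxEquiv (hlam : IsSpeed lam) :
    Lp E 2 (weightedMeasure lam) ≃ₗᵢ[ℂ] IntervalL2 E τ.total :=
  LinearIsometryEquiv.ofSurjective (τ.fluxIsometry hlam) (τ.fluxIsometry_surjective hlam)

theorem fluxEquiv_coeFn (hlam : IsSpeed lam) (g : Lp E 2 (weightedMeasure lam)) :
    τ.fluxEquiv hlam g =ᵐ[volume.restrict (Ioo 0 τ.total)] τ.flux g :=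
  τ.fluxIsometry_coeFn hlam g

/-- Here the Jacobian cancels the factor `speed`; primitives in travel time are thus primitives in
space, and `-d/dζ (lam g)` becomes `-d/ds`. -/
theorem integral_flux (f : ℝ → E) {s : ℝ} (hs : 0 ≤ s) :
    ∫ r in (0 : ℝ)..s, τ.flux f r = ∫ ζ in (0 : ℝ)..τ.time.symm s, f ζ := by
  have hs' : 0 ≤ τ.time.symm s := by
    rw [← τ.symm_zero]
    exact τ.time.symm.monotone hs
  rw [intervalIntegral.integral_of_le hs, intervalIntegral.integral_of_le hs']
  have h := τ.measurePreserving_symm.setIntegral_preimage_emb τ.measurableEmbedding_symm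
    (fun ζ => ((τ.speed ζ : ℝ) : ℂ) • f ζ) (Ioc 0 (τ.time.symm s))
  rw [τ.time.symm.preimage_Ioc, OrderIso.symm_symm, τ.time_zero, OrderIso.apply_symm_apply] at h
  refine h.trans ?_
  rw [slowness, setIntegral_withDensity_eq_setIntegral_smul τ.measurable_slowness _
    measurableSet_Ioc]
  refine integral_congr_ae (.of_forall fun ζ => ?_)
  have hp := (τ.speed_pos ζ)
  simp only
  rw [NNReal.smul_def, NNReal.coe_inv, Real.coe_toNNReal _ hp.le, Complex.coe_smul, smul_smul,
    inv_mul_cancel₀ hp.ne', one_smul]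

theorem integral_fluxEquiv (hlam : IsSpeed lam) (f : Lp E 2 (weightedMeasure lam)) {s : ℝ}
    (hs : s ∈ Icc 0 τ.total) :
    ∫ r in (0 : ℝ)..s, τ.fluxEquiv hlam f r = ∫ ζ in (0 : ℝ)..τ.time.symm s, f ζ := by
  rw [intervalIntegral_congr_ae_restrict (τ.fluxEquiv_coeFn hlam f) hs, τ.integral_flux _ hs.1]

theorem symm_mem_Icc {s : ℝ} (hs : s ∈ Icc 0 τ.total) : τ.time.symm s ∈ Icc 0 1 := by
  rw [← τ.symm_zero, ← τ.symm_total]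
  exact ⟨τ.time.symm.monotone hs.1, τ.time.symm.monotone hs.2⟩

end TravelTime

/-! ### The transport graph in the travel time coordinate -/

theorem MeasureTheory.MemLp.of_weighted {n : ℕ} {lam : ℝ → ℝ} (hlam : IsSpeed lam)
    {f : ℝ → EuclideanSpace ℂ (Fin n)} (hf : MemLp f 2 (weightedMeasure lam)) :
    MemLp f 2 unitMeasure := by
  obtain ⟨ε, hε, hlow⟩ := hlam.bounded_below
  refine hf.of_measure_le_smul (c := (ENNReal.ofReal ε)⁻¹)
    (ENNReal.inv_ne_top.2 (by simpa using hε)) ?_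
  have h1 : ENNReal.ofReal ε • unitMeasure ≤ weightedMeasure lam := by
    rw [← withDensity_const]
    refine withDensity_mono ?_
    filter_upwards [hlow] with s hs
    exact ENNReal.ofReal_le_ofReal hs
  calc unitMeasure = (ENNReal.ofReal ε)⁻¹ • ENNReal.ofReal ε • unitMeasure := by
        rw [smul_smul, ENNReal.inv_mul_cancel (by simpa using hε) ENNReal.ofReal_ne_top, one_smul]
    _ ≤ (ENNReal.ofReal ε)⁻¹ • weightedMeasure lam := by gcongr

/-- The boundary condition `K c + Q d = 0`. -/
def BoundaryRel {n : ℕ} (K Q : Matrix (Fin n) (Fin n) ℂ) (c d : EuclideanSpace ℂ (Fin n)) : Prop :=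
  K *ᵥ c.ofLp + Q *ᵥ d.ofLp = 0

/-- Both relations say that the flux equals a constant minus the primitive of the second component,
with matching endpoint values; `integral_fluxEquiv` translates one primitive into the other. -/
theorem mem_transportGraph_iff {n : ℕ} {lam : ℝ → ℝ} (hlam : IsSpeed lam) (τ : TravelTime lam)
    (M : ℝ → Matrix (Fin n) (Fin n) ℂ) (K L : Matrix (Fin n) (Fin n) ℂ)
    (g f : StateSpace n lam) :
    (g, f) ∈ transportGraph hlam M K L ↔ (τ.fluxEquiv hlam g, τ.fluxEquiv hlam f) ∈
      transportRel τ.total (BoundaryRel K (L * fundamentalMatrix lam M 1)) := by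
  have hTT : τ.total ∈ Icc 0 τ.total := right_mem_Icc.2 τ.total_pos.le
  constructor
  · rintro ⟨h, h', H, B, hf⟩
    have hint : ∀ ζ ∈ Icc (0 : ℝ) 1, h 0 - ∫ r in (0 : ℝ)..ζ, f r = h ζ := by
      intro ζ hζ
      rw [intervalIntegral_congr_ae_restrict hf hζ, H.integral_eq ζ hζ]
      simp only [Pi.neg_apply, intervalIntegral.integral_neg, sub_neg_eq_add]
    refine ⟨h 0, ?_, ?_⟩
    · filter_upwards [τ.fluxEquiv_coeFn hlam g, τ.ae_comp_symm H.ae_eq,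
        τ.ae_comp_symm τ.speed_ae_eq, ae_restrict_mem measurableSet_Ioo] with s h1 h2 h3 hs
      have hs' := Ioo_subset_Icc_self hs
      rw [h1, τ.integral_fluxEquiv hlam f hs', hint _ (τ.symm_mem_Icc hs'), TravelTime.flux, h3]
      exact h2
    · simp only
      rw [τ.integral_fluxEquiv hlam f hTT, τ.symm_total, hint 1 (right_mem_Icc.2 zero_le_one)]
      exact B
  · rintro ⟨c, hg, hb⟩
    refine ⟨fun ζ => c - ∫ r in (0 : ℝ)..ζ, f r, -f, ⟨?_, ((Lp.memLp f).of_weighted hlam).neg, ?_⟩,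
      ?_, ?_⟩
    · refine τ.ae_of_ae_comp_symm ?_
      filter_upwards [τ.fluxEquiv_coeFn hlam g, hg,
        τ.ae_comp_symm τ.speed_ae_eq, ae_restrict_mem measurableSet_Ioo] with s h1 h2 h3 hs
      rw [← τ.integral_fluxEquiv hlam f (Ioo_subset_Icc_self hs), ← h2, h1, TravelTime.flux, h3]
    · intro ζ _
      simp [sub_eq_add_neg]
    · simp only [τ.integral_fluxEquiv hlam f hTT, τ.symm_total] at hb
      simpa [BoundaryRel] using hb
    · rw [neg_neg]

/-! ### The generation theorem -/

/-- Solving the boundary condition for the inflow gives `c = -K⁻¹ Q d`. -/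
theorem exists_generates_of_isUnit {n : ℕ} {T : ℝ} (hT : 0 < T) {K Q : Matrix (Fin n) (Fin n) ℂ}
    (hK : IsUnit K) : ∃ S : C0Semigroup (IntervalL2 (EuclideanSpace ℂ (Fin n)) T),
      ∀ x y, (x, y) ∈ transportRel T (BoundaryRel K Q) ↔ S.InGenerator x y := by
  have hdet := (Matrix.isUnit_iff_isUnit_det K).1 hK
  let B := Matrix.toEuclideanCLM (𝕜 := ℂ) (-(K⁻¹ * Q))
  have hB : BoundaryRel K Q = fun c d => c = B d := by
    funext c d
    refine propext ?_
    have h1 : (B d).ofLp = -(K⁻¹ *ᵥ (Q *ᵥ d.ofLp)) := by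
      rw [Matrix.mulVec_mulVec, ← Matrix.neg_mulVec]
      rfl
    rw [BoundaryRel, ← (WithLp.ofLp_injective 2).eq_iff, h1, add_eq_zero_iff_eq_neg]
    constructor
    · intro h
      rw [← neg_eq_iff_eq_neg.2 h, Matrix.mulVec_neg, Matrix.mulVec_mulVec,
        Matrix.nonsing_inv_mul K hdet, neg_neg, Matrix.one_mulVec]
    · intro h
      rw [h, Matrix.mulVec_neg, Matrix.mulVec_mulVec, Matrix.mul_nonsing_inv K hdet,
        Matrix.one_mulVec]
  rw [hB]
  exact exists_generates_transportRel hT B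

/-- A left null vector `u` of `K` either kills `Q` too, giving too few boundary conditions and
eigenvalues everywhere on the real line, or it isolates a condition on the outflow alone. -/
theorem not_generates_of_not_isUnit {n : ℕ} {T : ℝ} (hT : 0 < T) {K Q : Matrix (Fin n) (Fin n) ℂ}
    (hK : ¬IsUnit K) : ¬∃ S : C0Semigroup (IntervalL2 (EuclideanSpace ℂ (Fin n)) T),
      ∀ x y, (x, y) ∈ transportRel T (BoundaryRel K Q) ↔ S.InGenerator x y := by
  have hdet : K.det = 0 := by
    rwa [Matrix.isUnit_iff_isUnit_det, isUnit_iff_ne_zero, not_not] at hK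
  obtain ⟨u, hu, huK⟩ := Matrix.exists_vecMul_eq_zero_iff.2 hdet
  by_cases huQ : u ᵥ* Q = 0
  · refine not_generates_of_eigenvectors hT fun a => ?_
    set z : ℂ := (Real.exp (-(a * T)) : ℂ)
    have hz : (K + z • Q).det = 0 := Matrix.exists_vecMul_eq_zero_iff.1
      ⟨u, hu, by rw [Matrix.vecMul_add, huK, Matrix.vecMul_smul, huQ, smul_zero, add_zero]⟩
    obtain ⟨c, hc, hKc⟩ := Matrix.exists_mulVec_eq_zero_iff.2 hz
    refine ⟨WithLp.toLp 2 c, fun h => hc (by simpa using congrArg WithLp.ofLp h), ?_⟩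
    rw [← Complex.coe_smul]
    rw [Matrix.add_mulVec, Matrix.smul_mulVec, ← Matrix.mulVec_smul] at hKc
    exact hKc
  -- The conjugate in `β` compensates the conjugate-linear first slot of the inner product, so that
  -- `⟨β, d⟩ = u Q d`.
  · refine not_generates_of_outflow_constraint hT (β := WithLp.toLp 2 (star (u ᵥ* Q)))
      (fun h => huQ ?_) (fun c d hcd => ?_) (by simp [BoundaryRel])
    · have := congrArg WithLp.ofLp h
      simpa using this
    · rw [EuclideanSpace.inner_eq_star_dotProduct]
      simp only [star_star]
      have h1 := congrArg (u ⬝ᵥ ·) hcd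
      simp only [dotProduct_add, Matrix.dotProduct_mulVec, huK, zero_dotProduct, zero_add,
        dotProduct_zero] at h1
      rw [dotProduct_comm]
      exact h1

theorem mainTheorem3 {n : ℕ} (lam : ℝ → ℝ) (hlam : IsSpeed lam)
    (M : ℝ → Matrix (Fin n) (Fin n) ℂ) (hM : IsBoundedMatrixFunction M)
    (K L : Matrix (Fin n) (Fin n) ℂ) :
    GeneratesC0Semigroup (transportOperator hlam M K L) ↔ IsUnit K := by
  obtain ⟨τ⟩ := nonempty_travelTime hlam
  rw [generatesC0Semigroup_iff_of_equiv _ (τ.fluxEquiv hlam).toContinuousLinearEquiv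
    (transportRel τ.total (BoundaryRel K (L * fundamentalMatrix lam M 1))) fun x y => by
      rw [transportOperator_graph]
      exact mem_transportGraph_iff hlam τ M K L x y]
  exact ⟨fun h => by_contra fun hK => not_generates_of_not_isUnit τ.total_pos hK h,
    fun hK => exists_generates_of_isUnit τ.total_pos hK⟩
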